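/- Let $I\subseteq\mathbb{R}$ be an open interval, $f:I\to\mathbb{R}$ a smooth positive function, and let $\bar M=I\times\mathbb{S}^n$ carry the warped product metric $\langle\cdot,\cdot\rangle=dt^2+f(t)^2\,d\sigma^2$, where $t$ is the coordinate on $I$, $d\sigma^2$ is the standard metric of the unit sphere $\mathbb{S}^n\subset\mathbb{R}^{n+1}$, and $\partial_t$ is the coordinate vector field of the $I$-factor. Let $\mathbf{x}:M^k\to\bar M$ be an isometric immersion of a $k$-dimensional Riemannian manifold, with second fundamental form $\alpha$ (the normal part of $\bar\nabla$ on tangent fields), Weingarten operators $A_\xi$, defined by $\langle A_\xi u,v\rangle=\langle\alpha(u,v),\xi\rangle$, normal connection $\nabla^\perp$ (the normal part of $\bar\nabla$ on normal fields), and Levi-Civita connections $\nabla$ of $M$ and $\bar\nabla$ of $\bar M$. Along $\mathbf{x}$ write $$\partial_t=T+\varrho,$$ where $T$ is tangent to $M$ (tangent vectors of $M$ are identified with their images under $d\mathbf{x}$) and $\varrho$ is normal to $M$. **Proposition 3.1.** For every $p\in M$ and every $u\in T_pM$, $$\alpha(u,T)+\nabla^\perp_u\varrho=-\frac{f'(t)}{f(t)}\,\langle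 u,T\rangle\,\varrho,$$ $$\nabla_uT-A_\varrho u=\frac{f'(t)}{f(t)}\,\bigl(u-\langle u,T\rangle T\bigr),$$ where $f$ and $f'$ are evaluated at the $t$-coordinate of $\mathbf{x}(p)$. -/

import Mathlib

set_option maxSynthPendingDepth 3
set_option linter.unusedSectionVars false

open Set Bundle Module
open scoped Manifold ContDiff Topology

noncomputable section
namespace SubmanifoldGeometry

section General

variable {E : Type*} [NormedAddCommGroup E] [NormedSpace ℝ E]
  {H : Type*} [TopologicalSpace H] {I : ModelWithCorners ℝ E H}
  {M : Type*} [TopologicalSpace M] [ChartedSpace H M] [IsManifold I ∞ M]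

variable (I M) in
/-- A smooth Riemannian metric on the manifold `M`. -/
abbrev SmoothMetric : Type _ := ContMDiffRiemannianMetric I ∞ E (TangentSpace I : M → Type _)

variable (I) in
/-- The components, in the coordinate frame of the preferred chart at `p`, of tangent vectors at `q`. -/
def coord (p q : M) : TangentSpace I q →L[ℝ] E :=
  (trivializationAt E (TangentSpace I : M → Type _) p).continuousLinearMapAt ℝ q

variable (I) in
/-- The tangent vector at `q` with given (constant) components in the coordinate frame of the
preferred chart at `p`; the inverse of `coord I p q` for `q` in the chart domain. -/
def frame (p q : M) : E →L[ℝ] TangentSpace I q :=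
  (trivializationAt E (TangentSpace I : M → Type _) p).symmL ℝ q

/-- The metric at `q` expressed in the coordinate frame of the preferred chart at `p`, i.e. the
matrix `g_ij` as a bilinear form on the model space. -/
def gram (g : SmoothMetric I M) (p q : M) : E →L[ℝ] E →L[ℝ] ℝ :=
  (ContinuousLinearMap.precomp ℝ (frame I p q)) ∘L (g.inner q) ∘L (frame I p q)

/-- The derivatives at `p` of the metric coefficients: `gramDeriv g p u v w` is the derivative of
`g(v, w)` in the direction `u`, where `v`, `w` have constant components in the chart at `p`. -/
def gramDeriv (g : SmoothMetric I M) (p : M) : E →L[ℝ] E →L[ℝ] E →L[ℝ] ℝ :=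
  mvfderiv I (gram g p) p ∘L frame I p p

/-- The Christoffel symbols at `p` in the preferred chart at `p`, as the map `u ↦ Γ(u, v)`, where
`g(Γ(u, v), z) = (∂_u g(v, z) + ∂_v g(u, z) - ∂_z g(v, u)) / 2`. -/
def christoffel (g : SmoothMetric I M) (p : M) (v : E) : E →L[ℝ] E :=
  (gram g p p).inverse ∘L ((1 / 2 : ℝ) •
    ((gramDeriv g p).flip v + gramDeriv g p v - ((gramDeriv g p).flip v).flip))

theorem christoffel_add (g : SmoothMetric I M) (p : M) (v w : E) :
    christoffel g p (v + w) = christoffel g p v + christoffel g p w := by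
  ext u
  simp only [christoffel, ContinuousLinearMap.comp_apply, add_apply,
    smul_apply, sub_apply, ← map_add, ← smul_add]
  congr 2
  ext z
  simp
  ring

theorem christoffel_smul (g : SmoothMetric I M) (p : M) (c : ℝ) (v : E) :
    christoffel g p (c • v) = c • christoffel g p v := by
  ext u
  simp only [christoffel, ContinuousLinearMap.comp_apply,
    smul_apply, sub_apply, ← map_smul]
  congr 1
  ext z
  simp
  ring

theorem isInvertible_inner [FiniteDimensional ℝ E] (g : SmoothMetric I M) (p : M) :
    (g.inner p).IsInvertible := by
  let _ : RiemannianBundle (TangentSpace I : M → Type _) := ⟨g.toRiemannianMetric⟩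
  have : FiniteDimensional ℝ (TangentSpace I p) := inferInstanceAs (FiniteDimensional ℝ E)
  have : CompleteSpace (TangentSpace I p) := FiniteDimensional.complete ℝ _
  refine ⟨(InnerProductSpace.toDual ℝ (TangentSpace I p)).toContinuousLinearEquiv, ?_⟩
  ext v w
  rfl

theorem coord_frame (p : M) (w : E) : coord I p p (frame I p p w) = w :=
  (trivializationAt E (TangentSpace I : M → Type _) p).continuousLinearMapAt_symmL
    (mem_baseSet_trivializationAt E _ p) w

theorem frame_coord (p : M) (w : TangentSpace I p) : frame I p p (coord I p p w) = w :=
  (trivializationAt E (TangentSpace I : M → Type _) p).symmL_continuousLinearMapAt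
    (mem_baseSet_trivializationAt E _ p) w

theorem mdifferentiableAt_coord {σ : ∀ q : M, TangentSpace I q} {p : M}
    (hσ : MDifferentiableAt I I.tangent (fun q => (⟨q, σ q⟩ : TangentBundle I M)) p) :
    MDifferentiableAt I 𝓘(ℝ, E) (fun q => coord I p q (σ q)) p := by
  rw [mdifferentiableAt_section] at hσ
  refine hσ.congr_of_eventuallyEq ?_
  filter_upwards [(trivializationAt E (TangentSpace I : M → Type _) p).open_baseSet.mem_nhds
    (mem_baseSet_trivializationAt E _ p)] with q hq
  simp [coord, Trivialization.coe_linearMapAt_of_mem _ hq]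

theorem mdifferentiableAt_frame (p : M) (v : E) :
    MDifferentiableAt I I.tangent
      (fun q => (⟨q, frame I p q v⟩ : TangentBundle I M)) p := by
  rw [mdifferentiableAt_section]
  refine (mdifferentiableAt_const (c := v)).congr_of_eventuallyEq ?_
  filter_upwards [(trivializationAt E (TangentSpace I : M → Type _) p).open_baseSet.mem_nhds
    (mem_baseSet_trivializationAt E _ p)] with q hq
  have := (trivializationAt E (TangentSpace I : M → Type _) p).continuousLinearMapAt_symmL hq v
    (R := ℝ)
  simp only [Trivialization.continuousLinearMapAt_apply,
    Trivialization.coe_linearMapAt_of_mem _ hq] at this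
  exact this

/-- The Levi-Civita connection of `g`: in the chart at `p` it is `∇_u σ = ∂_u σ + Γ(u, σ)`. -/
def leviCivita (g : SmoothMetric I M) :
    CovariantDerivative I E (TangentSpace I : M → Type _) where
  toFun σ p := frame I p p ∘L
    (mvfderiv I (fun q => coord I p q (σ q)) p +
      christoffel g p (coord I p p (σ p)) ∘L coord I p p)
  isCovariantDerivativeOnUniv := by
    constructor
    · intro σ σ' p hσ hσ' _
      ext u
      have := mvfderiv_add (mdifferentiableAt_coord hσ) (mdifferentiableAt_coord hσ')
      have h2 : (fun q => coord I p q ((σ + σ') q)) =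
        (fun q => coord I p q (σ q)) + (fun q => coord I p q (σ' q)) := by
        ext q; simp
      rw [h2, this]
      simp [christoffel_add]
      abel
    · intro σ f p hσ hf _
      ext u
      have := mvfderiv_smul hf (mdifferentiableAt_coord hσ)
      have h2 : (fun q => coord I p q ((f • σ) q)) = f • (fun q => coord I p q (σ q)) := by
        ext q; simp
      rw [h2, this]
      simp [frame_coord, christoffel_smul]
      module


variable {E' : Type*} [NormedAddCommGroup E'] [NormedSpace ℝ E']
  {H' : Type*} [TopologicalSpace H'] {J : ModelWithCorners ℝ E' H'}
  {N : Type*} [TopologicalSpace N] [ChartedSpace H' N] [IsManifold J ∞ N]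

/-- A smooth map `M → N` with `⟨dx u, dx v⟩ = ⟨u, v⟩`. Its differential is then injective, so that it
is an immersion. -/
structure IsometricImmersion (g : SmoothMetric I M) (h : SmoothMetric J N) where
  /-- The underlying map. -/
  toFun : M → N
  contMDiff_toFun : ContMDiff I J ∞ toFun
  isometric : ∀ (p : M) (u v : TangentSpace I p),
    h.inner (toFun p) (mfderiv I J toFun p u) (mfderiv I J toFun p v) = g.inner p u v

/-- The covariant derivative, along a map `x : M → N`, of a field `W` along `x` (that is,
`W q ∈ T_{x q} N`), induced by a connection on `N`: if `W = ∑ Wⁱ (e_i ∘ x)` in the coordinate frame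
`e_i` of the preferred chart at `x p`, then
`∇_u W = ∑ dWⁱ(u) e_i + ∇_{dx u} (∑ Wⁱ(p) e_i)` at `p`. -/
def pullbackDerivative (cov : CovariantDerivative J E' (TangentSpace J : N → Type _)) (x : M → N)
    (W : ∀ q : M, TangentSpace J (x q)) (p : M) : TangentSpace I p →L[ℝ] TangentSpace J (x p) :=
  frame J (x p) (x p) ∘L mvfderiv I (fun q => coord J (x p) (x q) (W q)) p +
    cov (fun y => frame J (x p) y (coord J (x p) (x p) (W p))) (x p) ∘L mfderiv I J x p

theorem pullbackDerivative_add (cov : CovariantDerivative J E' (TangentSpace J : N → Type _))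
    (x : M → N) {W W' : ∀ q : M, TangentSpace J (x q)} {p : M}
    (hW : MDifferentiableAt I 𝓘(ℝ, E') (fun q => coord J (x p) (x q) (W q)) p)
    (hW' : MDifferentiableAt I 𝓘(ℝ, E') (fun q => coord J (x p) (x q) (W' q)) p) :
    pullbackDerivative (I := I) cov x (fun q => W q + W' q) p =
      pullbackDerivative cov x W p + pullbackDerivative cov x W' p := by
  have h1 := mvfderiv_fun_add hW hW'
  have h2 := cov.isCovariantDerivativeOn.add
    (mdifferentiableAt_frame (I := J) (x p) (coord J (x p) (x p) (W p)))
    (mdifferentiableAt_frame (I := J) (x p) (coord J (x p) (x p) (W' p)))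
  have h3 : (fun y => frame J (x p) y (coord J (x p) (x p) (W p + W' p))) =
      (fun y => frame J (x p) y (coord J (x p) (x p) (W p))) +
      (fun y => frame J (x p) y (coord J (x p) (x p) (W' p))) := by
    ext y; simp
  ext u
  simp only [pullbackDerivative]
  rw [h3, h2]
  simp only [map_add, h1]
  simp
  abel

theorem pullbackDerivative_smul (cov : CovariantDerivative J E' (TangentSpace J : N → Type _))
    (x : M → N) (c : ℝ) {W : ∀ q : M, TangentSpace J (x q)} {p : M}
    (hW : MDifferentiableAt I 𝓘(ℝ, E') (fun q => coord J (x p) (x q) (W q)) p) :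
    pullbackDerivative (I := I) cov x (fun q => c • W q) p =
      c • pullbackDerivative cov x W p := by
  have h1 := mvfderiv_fun_smul (mdifferentiableAt_const (c := c)) hW
  have h2 := cov.isCovariantDerivativeOn.smul_const c
    (mdifferentiableAt_frame (I := J) (x p) (coord J (x p) (x p) (W p)))
  have h3 : (fun y => frame J (x p) y (coord J (x p) (x p) (c • W p))) =
      c • (fun y => frame J (x p) y (coord J (x p) (x p) (W p))) := by
    ext y; simp
  ext u
  simp only [pullbackDerivative]
  rw [h3, h2]
  simp only [map_smul, h1]
  simp [mvfderiv_const]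

namespace IsometricImmersion

variable {g : SmoothMetric I M} {h : SmoothMetric J N} (x : IsometricImmersion g h)

/-- The differential `dx : T_p M → T_{x p} N`. -/
def differential (p : M) : TangentSpace I p →L[ℝ] TangentSpace J (x.toFun p) :=
  mfderiv I J x.toFun p

/-- The tangential component, as a vector of `T_p M`, of a vector of `T_{x p} N`: the image under `dx`
of `x.tangentPart p w` is the orthogonal projection of `w` to `dx (T_p M)`. -/
def tangentPart (p : M) : TangentSpace J (x.toFun p) →L[ℝ] TangentSpace I p :=
  (g.inner p).inverse ∘L ContinuousLinearMap.precomp ℝ (x.differential p) ∘L h.inner (x.toFun p)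

/-- The component of a vector of `T_{x p} N` orthogonal to `dx (T_p M)`. -/
def normalPart (p : M) :
    TangentSpace J (x.toFun p) →L[ℝ] TangentSpace J (x.toFun p) :=
  ContinuousLinearMap.id ℝ _ - x.differential p ∘L x.tangentPart p

theorem inner_tangentPart [FiniteDimensional ℝ E] (p : M) (w : TangentSpace J (x.toFun p))
    (v : TangentSpace I p) :
    g.inner p (x.tangentPart p w) v = h.inner (x.toFun p) w (x.differential p v) := by
  simp [tangentPart, (isInvertible_inner g p).self_apply_inverse]

theorem differential_tangentPart_add_normalPart (p : M) (w : TangentSpace J (x.toFun p)) :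
    x.differential p (x.tangentPart p w) + x.normalPart p w = w := by
  simp [normalPart]

theorem inner_normalPart [FiniteDimensional ℝ E] (p : M) (w : TangentSpace J (x.toFun p))
    (v : TangentSpace I p) :
    h.inner (x.toFun p) (x.normalPart p w) (x.differential p v) = 0 := by
  have := x.isometric p (x.tangentPart p w) v
  simp only [normalPart, sub_apply, map_sub, ContinuousLinearMap.id_apply,
    ContinuousLinearMap.comp_apply]
  rw [← x.inner_tangentPart, ← this]
  simp [differential]

/-- The Levi-Civita connection of the target, acting on fields along the immersion. -/
def covariantDerivative (W : ∀ q : M, TangentSpace J (x.toFun q)) (p : M) :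
    TangentSpace I p →L[ℝ] TangentSpace J (x.toFun p) :=
  pullbackDerivative (leviCivita h) x.toFun W p

/-- The normal connection `∇^⊥_u ξ = (∇̄_u ξ)^⊥`. -/
def normalConnection (ξ : ∀ q : M, TangentSpace J (x.toFun q)) (p : M) :
    TangentSpace I p →L[ℝ] TangentSpace J (x.toFun p) :=
  x.normalPart p ∘L x.covariantDerivative ξ p

theorem mdifferentiableAt_coord_differential (p : M) (v : E) :
    MDifferentiableAt I 𝓘(ℝ, E')
      (fun q => coord J (x.toFun p) (x.toFun q) (x.differential q (frame I p q v))) p := by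
  have h1 := mdifferentiableAt_frame (I := I) p v
  have h2 : MDifferentiableAt I J.tangent
      (fun q => (⟨x.toFun q, x.differential q (frame I p q v)⟩ : TangentBundle J N)) p :=
    ((x.contMDiff_toFun.contMDiff_tangentMap (m := 1) (by norm_cast)).mdifferentiable
      one_ne_zero _).comp p h1
  rw [mdifferentiableAt_totalSpace] at h2
  refine h2.2.congr_of_eventuallyEq ?_
  filter_upwards [x.contMDiff_toFun.continuous.continuousAt.preimage_mem_nhds
    ((trivializationAt E' (TangentSpace J : N → Type _) (x.toFun p)).open_baseSet.mem_nhds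
    (mem_baseSet_trivializationAt E' _ (x.toFun p)))] with q hq
  rw [Set.mem_preimage] at hq
  simp [coord, Trivialization.coe_linearMapAt_of_mem _ hq]

/-- The map `u ↦ (∇̄_u (dx V))^⊥`, where `V` is the vector field on `M` near `p` that extends `v` with
constant components in the preferred chart at `p`. -/
def secondFundamentalFormAux (p : M) (v : TangentSpace I p) :
    TangentSpace I p →L[ℝ] TangentSpace J (x.toFun p) :=
  x.normalPart p ∘L
    x.covariantDerivative (fun q => x.differential q (frame I p q (coord I p p v))) p

theorem secondFundamentalFormAux_add (p : M) (v w : TangentSpace I p) :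
    x.secondFundamentalFormAux p (v + w) =
      x.secondFundamentalFormAux p v + x.secondFundamentalFormAux p w := by
  simp only [secondFundamentalFormAux, covariantDerivative]
  rw [← ContinuousLinearMap.comp_add, ← pullbackDerivative_add _ _
    (x.mdifferentiableAt_coord_differential p _) (x.mdifferentiableAt_coord_differential p _)]
  simp only [map_add]

theorem secondFundamentalFormAux_smul (p : M) (c : ℝ) (v : TangentSpace I p) :
    x.secondFundamentalFormAux p (c • v) = c • x.secondFundamentalFormAux p v := by
  simp only [secondFundamentalFormAux, covariantDerivative]
  rw [← ContinuousLinearMap.comp_smul, ← pullbackDerivative_smul _ _ c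
    (x.mdifferentiableAt_coord_differential p _)]
  simp only [map_smul]

/-- The second fundamental form `α(u, v) = (∇̄_u (dx V))^⊥`, `V` extending `v`. -/
def secondFundamentalForm [FiniteDimensional ℝ E] (p : M) :
    TangentSpace I p →L[ℝ] TangentSpace I p →L[ℝ] TangentSpace J (x.toFun p) :=
  have : FiniteDimensional ℝ (TangentSpace I p) := inferInstanceAs (FiniteDimensional ℝ E)
  have : T2Space (TangentSpace I p) := inferInstanceAs (T2Space E)
  (LinearMap.mk₂ ℝ (fun u v => x.secondFundamentalFormAux p v u)
    (by simp) (by simp) (by simp [secondFundamentalFormAux_add])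
    (by simp [secondFundamentalFormAux_smul])).toContinuousBilinearMap

/-- The Weingarten endomorphism `A_ξ` of a normal vector `ξ`: `⟨A_ξ u, v⟩ = ⟨α(u, v), ξ⟩`. -/
def weingarten [FiniteDimensional ℝ E] (p : M) (ξ : TangentSpace J (x.toFun p)) :
    TangentSpace I p →L[ℝ] TangentSpace I p :=
  (g.inner p).inverse ∘L
    (ContinuousLinearMap.postcomp (TangentSpace I p) (h.inner (x.toFun p) ξ) ∘L
    x.secondFundamentalForm p)

theorem inner_weingarten [FiniteDimensional ℝ E] (p : M) (ξ : TangentSpace J (x.toFun p))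
    (u v : TangentSpace I p) :
    g.inner p (x.weingarten p ξ u) v = h.inner (x.toFun p) (x.secondFundamentalForm p u v) ξ := by
  rw [h.symm]
  simp [weingarten, (isInvertible_inner g p).self_apply_inverse]

end IsometricImmersion

open Metric TopologicalSpace

theorem isVonNBounded_of_pos {F : Type*} [NormedAddCommGroup F] [NormedSpace ℝ F]
    [FiniteDimensional ℝ F] (B : F →L[ℝ] F →L[ℝ] ℝ) (hB : ∀ v, v ≠ 0 → 0 < B v v) :
    Bornology.IsVonNBounded ℝ {v : F | B v v < 1} := by
  rw [NormedSpace.isVonNBounded_iff]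
  rcases subsingleton_or_nontrivial F with hF | hF
  · exact (Set.toFinite _).isBounded
  obtain ⟨w, hw, hmin⟩ := (isCompact_sphere (0 : F) 1).exists_isMinOn
    (NormedSpace.sphere_nonempty.2 zero_le_one) (f := fun v => B v v) (by fun_prop)
  have hw0 : w ≠ 0 := by rintro rfl; simp at hw
  have hc := hB w hw0
  refine isBounded_iff_forall_norm_le.2 ⟨Real.sqrt (1 / B w w), fun v hv => ?_⟩
  apply Real.le_sqrt_of_sq_le
  rw [le_div_iff₀ hc]
  by_cases hv0 : v = 0
  · simp [hv0]
  have hn : 0 < ‖v‖ := norm_pos_iff.2 hv0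
  have := hmin (a := ‖v‖⁻¹ • v) (by simp [norm_smul, hn.ne'])
  simp only [Set.mem_ofPred_eq, map_smul, smul_apply, smul_eq_mul] at this hv
  have h2 : ‖v‖ ^ 2 * B w w ≤ ‖v‖ ^ 2 * (‖v‖⁻¹ * (‖v‖⁻¹ * B v v)) :=
    mul_le_mul_of_nonneg_left this (by positivity)
  have h3 : ‖v‖ ^ 2 * (‖v‖⁻¹ * (‖v‖⁻¹ * B v v)) = B v v := by field_simp
  linarith

variable (I) in
/-- The pull-back `(v, w) ↦ ⟨dφ v, dφ w⟩` of the inner product of `F` under `φ : M → F`. -/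
def inducedForm {F : Type*} [NormedAddCommGroup F] [InnerProductSpace ℝ F] (φ : M → F) (q : M) :
    TangentSpace I q →L[ℝ] TangentSpace I q →L[ℝ] ℝ :=
  ContinuousLinearMap.precomp ℝ (mvfderiv I φ q) ∘L innerSL ℝ ∘L mvfderiv I φ q

theorem inducedForm_apply {F : Type*} [NormedAddCommGroup F] [InnerProductSpace ℝ F] (φ : M → F)
    (q : M) (v w : TangentSpace I q) :
    inducedForm I φ q v w = inner ℝ (mvfderiv I φ q v) (mvfderiv I φ q w) := rfl

theorem contMDiff_inducedForm {F : Type*} [NormedAddCommGroup F] [InnerProductSpace ℝ F]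
    {φ : M → F} (hφ : ContMDiff I 𝓘(ℝ, F) ∞ φ) :
    ContMDiff I (I.prod 𝓘(ℝ, E →L[ℝ] E →L[ℝ] ℝ)) ∞
      (fun q => TotalSpace.mk' (E →L[ℝ] E →L[ℝ] ℝ)
        (E := fun q : M => TangentSpace I q →L[ℝ] TangentSpace I q →L[ℝ] ℝ) q
        (inducedForm I φ q)) := by
  intro p
  rw [contMDiffAt_section]
  have hA : ContMDiffAt I 𝓘(ℝ, E →L[ℝ] F) ∞ (fun q => mvfderiv I φ q ∘L frame I p q) p := by
    have h1 := (hφ p).mfderiv_const (m := ∞) (by norm_cast)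
    refine h1.congr_of_eventuallyEq ?_
    filter_upwards [(trivializationAt E (TangentSpace I : M → Type _) p).open_baseSet.mem_nhds
      (mem_baseSet_trivializationAt E _ p)] with q hq
    ext v
    simp [inTangentCoordinates, ContinuousLinearMap.inCoordinates, mvfderiv, frame]
    rfl
  let L : F →L[ℝ] F →L[ℝ] ℝ := innerSL ℝ
  have hB := (hA.clm_precomp (F₃ := ℝ)).clm_comp
    ((contMDiffAt_const (c := L)).clm_comp hA)
  refine hB.congr_of_eventuallyEq ?_
  filter_upwards [(trivializationAt E (TangentSpace I : M → Type _) p).open_baseSet.mem_nhds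
    (mem_baseSet_trivializationAt E _ p)] with q hq
  ext v w
  rw [hom_trivializationAt_apply]
  rw [inCoordinates_apply_eq₂ hq hq (by simp)]
  refine Eq.trans (b := inducedForm I φ q (frame I p q v) (frame I p q w)) ?_ rfl
  have hs : ∀ v : E, frame I p q v =
      (trivializationAt E (TangentSpace I : M → Type _) p).symm q v := fun v =>
    Trivialization.symmL_apply _ hq v
  rw [hs, hs]
  simp

end General

section Warped

open Metric TopologicalSpace

variable (U : Opens ℝ) (n : ℕ)

/-- The cylinder `U × S^n`, for `U` open in `ℝ` (in particular, for an open interval `U`). -/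
abbrev Cylinder : Type := U × sphere (0 : EuclideanSpace ℝ (Fin (n + 1))) 1

variable {U n}

/-- The coordinate `t` on `U × S^n`. -/
def Cylinder.height (q : Cylinder U n) : ℝ := q.1

/-- The projection to `S^n`, seen in `ℝ^(n+1)`. -/
def Cylinder.spherical (q : Cylinder U n) : EuclideanSpace ℝ (Fin (n + 1)) := q.2

theorem Cylinder.contMDiff_height :
    ContMDiff (𝓘(ℝ, ℝ).prod (𝓡 n)) 𝓘(ℝ, ℝ) ∞ (Cylinder.height (U := U) (n := n)) :=
  contMDiff_subtype_val.comp contMDiff_fst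

theorem Cylinder.contMDiff_spherical :
    ContMDiff (𝓘(ℝ, ℝ).prod (𝓡 n)) 𝓘(ℝ, EuclideanSpace ℝ (Fin (n + 1))) ∞
      (Cylinder.spherical (U := U) (n := n)) := by
  have : Fact (finrank ℝ (EuclideanSpace ℝ (Fin (n + 1))) = n + 1) := ⟨finrank_euclideanSpace_fin⟩
  exact contMDiff_coe_sphere.comp contMDiff_snd

theorem mvfderiv_subtypeVal (t : U) (a : TangentSpace 𝓘(ℝ, ℝ) t) :
    mvfderiv 𝓘(ℝ, ℝ) (Subtype.val : U → ℝ) t a = a := by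
  have hd := (contMDiff_subtype_val (I := 𝓘(ℝ, ℝ)) (U := U) (n := 1) t).mdifferentiableAt one_ne_zero
  rw [hd.mvfderiv]
  have : writtenInExtChartAt 𝓘(ℝ, ℝ) 𝓘(ℝ, ℝ) t (Subtype.val : U → ℝ)
      =ᶠ[𝓝 (t : ℝ)] id := by
    filter_upwards [(extChartAt_target_mem_nhds (I := 𝓘(ℝ, ℝ)) t)] with s hs
    exact (extChartAt 𝓘(ℝ, ℝ) t).right_inv hs
  simp only [modelWithCornersSelf_coe, Set.range_id, fderivWithin_univ]
  have h2 := (this.fderiv_eq (𝕜 := ℝ)).trans fderiv_id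
  exact congrArg (fun A : ℝ →L[ℝ] ℝ => A a) h2

theorem Cylinder.mvfderiv_height (q : Cylinder U n) (v : TangentSpace (𝓘(ℝ, ℝ).prod (𝓡 n)) q) :
    mvfderiv (𝓘(ℝ, ℝ).prod (𝓡 n)) Cylinder.height q v = (v : ℝ × EuclideanSpace ℝ (Fin n)).1 := by
  have h := mvfderiv_comp_apply (I' := 𝓘(ℝ, ℝ).prod (𝓡 n)) (I := 𝓘(ℝ, ℝ)) (f := Prod.fst) (g := (Subtype.val : U → ℝ)) q ((contMDiff_subtype_val (n := 1) q.1).mdifferentiableAt one_ne_zero) (mdifferentiableAt_fst) v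
  refine h.trans ?_
  rw [mvfderiv_subtypeVal, mfderiv_fst]
  rfl


theorem Cylinder.mvfderiv_spherical (q : Cylinder U n) (v : TangentSpace (𝓘(ℝ, ℝ).prod (𝓡 n)) q) :
    mvfderiv (𝓘(ℝ, ℝ).prod (𝓡 n)) Cylinder.spherical q v =
      mvfderiv (𝓡 n) (Subtype.val : sphere (0 : EuclideanSpace ℝ (Fin (n + 1))) 1 →
        EuclideanSpace ℝ (Fin (n + 1))) q.2
        (v : ℝ × EuclideanSpace ℝ (Fin n)).2 := by
  have : Fact (finrank ℝ (EuclideanSpace ℝ (Fin (n + 1))) = n + 1) := ⟨finrank_euclideanSpace_fin⟩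
  have hd : MDifferentiableAt (𝓡 n) 𝓘(ℝ, EuclideanSpace ℝ (Fin (n + 1)))
      (Subtype.val : sphere (0 : EuclideanSpace ℝ (Fin (n + 1))) 1 →
        EuclideanSpace ℝ (Fin (n + 1))) q.2 :=
    (contMDiff_coe_sphere (m := 1) q.2).mdifferentiableAt one_ne_zero
  have h := mfderiv_comp_apply (I := 𝓘(ℝ, ℝ).prod (𝓡 n)) (f := Prod.snd) (x := q) hd
    mdifferentiableAt_snd v
  refine h.trans ?_
  rw [mfderiv_snd]
  rfl

theorem Cylinder.eq_zero {q : Cylinder U n} {v : TangentSpace (𝓘(ℝ, ℝ).prod (𝓡 n)) q}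
    (h1 : mvfderiv (𝓘(ℝ, ℝ).prod (𝓡 n)) Cylinder.height q v = 0)
    (h2 : mvfderiv (𝓘(ℝ, ℝ).prod (𝓡 n)) Cylinder.spherical q v = 0) : v = 0 := by
  have : Fact (finrank ℝ (EuclideanSpace ℝ (Fin (n + 1))) = n + 1) := ⟨finrank_euclideanSpace_fin⟩
  rw [Cylinder.mvfderiv_height] at h1
  rw [Cylinder.mvfderiv_spherical] at h2
  exact Prod.ext h1 (injective_mvfderiv_subtypeVal_sphere q.2 (h2.trans (map_zero _).symm))

/-- The vector field `∂_t`. -/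
def Cylinder.verticalField (q : Cylinder U n) : TangentSpace (𝓘(ℝ, ℝ).prod (𝓡 n)) q :=
  ((1 : ℝ), (0 : EuclideanSpace ℝ (Fin n)))

theorem Cylinder.mvfderiv_height_verticalField (q : Cylinder U n) :
    mvfderiv (𝓘(ℝ, ℝ).prod (𝓡 n)) Cylinder.height q q.verticalField = 1 :=
  Cylinder.mvfderiv_height q _

theorem Cylinder.mvfderiv_spherical_verticalField (q : Cylinder U n) :
    mvfderiv (𝓘(ℝ, ℝ).prod (𝓡 n)) Cylinder.spherical q q.verticalField = 0 :=
  (Cylinder.mvfderiv_spherical q _).trans (map_zero _)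

/-- The bilinear form `dt² + f(t)² dσ²`. -/
def warpedForm (f : ℝ → ℝ) (q : Cylinder U n) :
    TangentSpace (𝓘(ℝ, ℝ).prod (𝓡 n)) q →L[ℝ] TangentSpace (𝓘(ℝ, ℝ).prod (𝓡 n)) q →L[ℝ] ℝ :=
  inducedForm (𝓘(ℝ, ℝ).prod (𝓡 n)) Cylinder.height q +
    f q.1 ^ 2 • inducedForm (𝓘(ℝ, ℝ).prod (𝓡 n)) Cylinder.spherical q

theorem warpedForm_apply (f : ℝ → ℝ) (q : Cylinder U n) (v w : TangentSpace (𝓘(ℝ, ℝ).prod (𝓡 n)) q) :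
    warpedForm f q v w =
      inner ℝ (mvfderiv (𝓘(ℝ, ℝ).prod (𝓡 n)) Cylinder.height q v)
        (mvfderiv (𝓘(ℝ, ℝ).prod (𝓡 n)) Cylinder.height q w) +
      f q.1 ^ 2 * inner ℝ (mvfderiv (𝓘(ℝ, ℝ).prod (𝓡 n)) Cylinder.spherical q v)
        (mvfderiv (𝓘(ℝ, ℝ).prod (𝓡 n)) Cylinder.spherical q w) := rfl

theorem warpedForm_pos (f : ℝ → ℝ) (hpos : ∀ t ∈ U, 0 < f t) (q : Cylinder U n)
    (v : TangentSpace (𝓘(ℝ, ℝ).prod (𝓡 n)) q) (hv : v ≠ 0) : 0 < warpedForm f q v v := by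
  have hf := hpos q.1 q.1.2
  rw [warpedForm_apply]
  by_cases h1 : mvfderiv (𝓘(ℝ, ℝ).prod (𝓡 n)) Cylinder.height q v = 0
  · by_cases h2 : mvfderiv (𝓘(ℝ, ℝ).prod (𝓡 n)) Cylinder.spherical q v = 0
    · exact absurd (Cylinder.eq_zero h1 h2) hv
    · have := real_inner_self_pos.2 h2
      have h3 := real_inner_self_nonneg (x := mvfderiv (𝓘(ℝ, ℝ).prod (𝓡 n)) Cylinder.height q v)
      positivity
  · have := real_inner_self_pos.2 h1
    have h3 := real_inner_self_nonneg (x := mvfderiv (𝓘(ℝ, ℝ).prod (𝓡 n)) Cylinder.spherical q v)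
    positivity

theorem contMDiff_sq_warping (f : ℝ → ℝ) (hf : ContDiffOn ℝ ∞ f U) :
    ContMDiff (𝓘(ℝ, ℝ).prod (𝓡 n)) 𝓘(ℝ, ℝ) ∞ (fun q : Cylinder U n => f q.1 ^ 2) := by
  have h : ContMDiff (𝓘(ℝ, ℝ).prod (𝓡 n)) 𝓘(ℝ, ℝ) ∞ (fun q : Cylinder U n => f q.1) :=
    hf.contMDiffOn.comp_contMDiff Cylinder.contMDiff_height (fun q => q.1.2)
  exact h.pow 2

theorem contMDiff_warpedForm (f : ℝ → ℝ) (hf : ContDiffOn ℝ ∞ f U) :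
    ContMDiff (𝓘(ℝ, ℝ).prod (𝓡 n)) ((𝓘(ℝ, ℝ).prod (𝓡 n)).prod
      𝓘(ℝ, (ℝ × EuclideanSpace ℝ (Fin n)) →L[ℝ] (ℝ × EuclideanSpace ℝ (Fin n)) →L[ℝ] ℝ)) ∞
      (fun q : Cylinder U n => TotalSpace.mk'
        ((ℝ × EuclideanSpace ℝ (Fin n)) →L[ℝ] (ℝ × EuclideanSpace ℝ (Fin n)) →L[ℝ] ℝ)
        (E := fun q : Cylinder U n => TangentSpace (𝓘(ℝ, ℝ).prod (𝓡 n)) q →L[ℝ]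
          TangentSpace (𝓘(ℝ, ℝ).prod (𝓡 n)) q →L[ℝ] ℝ) q (warpedForm f q)) :=
  (contMDiff_inducedForm Cylinder.contMDiff_height).add_section
    (ContMDiff.smul_section (contMDiff_sq_warping f hf)
      (contMDiff_inducedForm Cylinder.contMDiff_spherical))

/-- The warped product metric `dt² + f(t)² dσ²` on `U × S^n`. -/
def warpedMetric (f : ℝ → ℝ) (hf : ContDiffOn ℝ ∞ f U) (hpos : ∀ t ∈ U, 0 < f t) :
    SmoothMetric (𝓘(ℝ, ℝ).prod (𝓡 n)) (Cylinder U n) where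
  inner q := warpedForm f q
  symm q v w := by
    simp only [warpedForm_apply, real_inner_comm]
  pos q v hv := warpedForm_pos f hpos q v hv
  isVonNBounded q := isVonNBounded_of_pos (F := ℝ × EuclideanSpace ℝ (Fin n)) (warpedForm f q)
    (warpedForm_pos f hpos q)
  contMDiff := contMDiff_warpedForm f hf

end Warped

end SubmanifoldGeometry

end

/-! ### Calculus in the coordinates of a chart. -/

namespace SubmanifoldGeometry

section Coordinates

variable {E : Type*} [NormedAddCommGroup E] [NormedSpace ℝ E]
  {H : Type*} [TopologicalSpace H] {I : ModelWithCorners ℝ E H} [I.Boundaryless]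
  {M : Type*} [TopologicalSpace M] [ChartedSpace H M] [IsManifold I ∞ M]
  {F : Type*} [NormedAddCommGroup F] [NormedSpace ℝ F]

/-! In a warped product the field `∂_t` is closed and conformal: `∇̄_v ∂_t = (f'/f)(v - ⟨v, ∂_t⟩
∂_t)`. Restrict this to `M`, write `∂_t = T + ϱ`, and use `⟨u, ∂_t⟩ = ⟨u, T⟩`. The Gauss formula
`∇̄_u T = ∇_u T + α(u, T)` and the Weingarten formula `∇̄_u ϱ = -A_ϱ u + ∇^⊥_u ϱ` then split the
identity into its normal and tangential parts, which are the two claims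
(`gauss_weingarten_of_covariantDerivative_eq`).

Since the connections are given by Christoffel symbols in the preferred chart at each point, the
classical facts have to be derived from these. Compatibility with the metric is `mvfderiv_inner`.
Vanishing torsion is `covariantDerivative_frame_symm`, from the symmetry of `Γ` and of second
derivatives. Together they yield the tangential Gauss formula by Koszul's argument.

For `∂_t` itself, its components in every product chart are the constants `(1, 0)`, so only a
Christoffel term remains (`christoffel_vertical`). It comes from the `t`-derivative of `f²`, the
only place where the metric depends on `t`.

No regularity of `T` or `ϱ` is assumed. It follows because `T` is the gradient of `t ∘ x`
(`mdifferentiableAt_coord_gradient`) and `ϱ = ∂_t - T`. -/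

theorem coord_frame_of_mem {p q : M} (hq : q ∈ (chartAt H p).source) (w : E) :
    coord I p q (frame I p q w) = w :=
  (trivializationAt E (TangentSpace I : M → Type _) p).continuousLinearMapAt_symmL hq w

theorem frame_coord_of_mem {p q : M} (hq : q ∈ (chartAt H p).source) (w : TangentSpace I q) :
    frame I p q (coord I p q w) = w :=
  (trivializationAt E (TangentSpace I : M → Type _) p).symmL_continuousLinearMapAt hq w

/-- The frame is the differential of the inverse chart, so this is the chain rule. Without boundary
the model has full range, and derivatives within the range become ordinary ones. -/
theorem mvfderiv_frame {p q : M} (hq : q ∈ (chartAt H p).source) {φ : M → F}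
    (hφ : MDifferentiableAt I 𝓘(ℝ, F) φ q) (w : E) :
    mvfderiv I φ q (frame I p q w) =
      fderiv ℝ (φ ∘ (extChartAt I p).symm) (extChartAt I p q) w := by
  have hq' : q ∈ (extChartAt I p).source := by rwa [extChartAt_source]
  have h1 : MDifferentiableAt 𝓘(ℝ, E) I (extChartAt I p).symm (extChartAt I p q) := by
    have := mdifferentiableWithinAt_extChartAt_symm (I := I) ((extChartAt I p).map_source hq')
    rwa [I.range_eq_univ, mdifferentiableWithinAt_univ] at this
  have hl := (extChartAt I p).left_inv hq'
  have h2 := mfderiv_comp_apply_of_eq (x := extChartAt I p q) hφ h1 hl w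
  have h3 : mfderiv 𝓘(ℝ, E) I (extChartAt I p).symm (extChartAt I p q) w = frame I p q w := by
    rw [frame, TangentBundle.symmL_trivializationAt hq, I.range_eq_univ, mfderivWithin_univ]
    rfl
  rw [mfderiv_eq_fderiv] at h2
  exact (h2.trans (congrArg (mfderiv I 𝓘(ℝ, F) φ q) h3)).symm

theorem mvfderiv_eq_fderiv {p : M} {φ : M → F} (hφ : MDifferentiableAt I 𝓘(ℝ, F) φ p)
    (u : TangentSpace I p) :
    mvfderiv I φ p u =
      fderiv ℝ (φ ∘ (extChartAt I p).symm) (extChartAt I p p) (coord I p p u) := by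
  rw [← mvfderiv_frame (mem_chart_source H p) hφ, frame_coord]

theorem differentiableAt_comp_extChartAt_symm_of_mem {p q : M}
    (hq : q ∈ (chartAt H p).source) {φ : M → F} (hφ : MDifferentiableAt I 𝓘(ℝ, F) φ q) :
    DifferentiableAt ℝ (φ ∘ (extChartAt I p).symm) (extChartAt I p q) := by
  have hq' : q ∈ (extChartAt I p).source := by rwa [extChartAt_source]
  have h1 : MDifferentiableAt 𝓘(ℝ, E) I (extChartAt I p).symm (extChartAt I p q) := by
    have := mdifferentiableWithinAt_extChartAt_symm (I := I) ((extChartAt I p).map_source hq')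
    rwa [I.range_eq_univ, mdifferentiableWithinAt_univ] at this
  rw [← (extChartAt I p).left_inv hq'] at hφ
  exact (hφ.comp _ h1).differentiableAt

theorem differentiableAt_comp_extChartAt_symm {p : M} {φ : M → F}
    (hφ : MDifferentiableAt I 𝓘(ℝ, F) φ p) :
    DifferentiableAt ℝ (φ ∘ (extChartAt I p).symm) (extChartAt I p p) :=
  differentiableAt_comp_extChartAt_symm_of_mem (mem_chart_source H p) hφ

theorem mvfderiv_clm_apply {G : Type*} [NormedAddCommGroup G] [NormedSpace ℝ G] {p : M}
    {B : M → F →L[ℝ] G} {c : M → F} (hB : MDifferentiableAt I 𝓘(ℝ, F →L[ℝ] G) B p)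
    (hc : MDifferentiableAt I 𝓘(ℝ, F) c p) (u : TangentSpace I p) :
    mvfderiv I (fun q => B q (c q)) p u = mvfderiv I B p u (c p) + B p (mvfderiv I c p u) := by
  rw [mvfderiv_eq_fderiv hB, mvfderiv_eq_fderiv hc, mvfderiv_eq_fderiv (hB.clm_apply hc)]
  have h := fderiv_clm_apply (differentiableAt_comp_extChartAt_symm hB)
    (differentiableAt_comp_extChartAt_symm hc)
  refine (congrArg (fun A : E →L[ℝ] G => A (coord I p p u)) h).trans ?_
  simp [add_comm]

theorem mvfderiv_clm_apply_const {G : Type*} [NormedAddCommGroup G] [NormedSpace ℝ G] {p : M}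
    {B : M → F →L[ℝ] G} (hB : MDifferentiableAt I 𝓘(ℝ, F →L[ℝ] G) B p) (c : F)
    (u : TangentSpace I p) :
    mvfderiv I (fun q => B q c) p u = mvfderiv I B p u c := by
  rw [mvfderiv_clm_apply hB mdifferentiableAt_const, mvfderiv_const]
  simp

theorem gram_apply (g : SmoothMetric I M) (p q : M) (v w : E) :
    gram g p q v w = g.inner q (frame I p q v) (frame I p q w) := rfl

theorem inner_eq_gram_coord (g : SmoothMetric I M) {p q : M} (hq : q ∈ (chartAt H p).source)
    (v w : TangentSpace I q) :
    g.inner q v w = gram g p q (coord I p q v) (coord I p q w) := by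
  rw [gram_apply, frame_coord_of_mem hq, frame_coord_of_mem hq]

theorem gram_symm (g : SmoothMetric I M) (p q : M) (v w : E) :
    gram g p q v w = gram g p q w v := g.symm q _ _

/-- The inverse is that of `g.inner q`, transported by `coord`. The whole chart domain, not just its
centre, is needed to differentiate gradients. -/
theorem isInvertible_gram_of_mem [FiniteDimensional ℝ E] (g : SmoothMetric I M) {p q : M}
    (hq : q ∈ (chartAt H p).source) :
    (gram g p q).IsInvertible := by
  apply ContinuousLinearMap.IsInvertible.of_inverse
    (g := coord I p q ∘L (g.inner q).inverse ∘L ContinuousLinearMap.precomp ℝ (coord I p q))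
  · ext v w
    simp only [ContinuousLinearMap.comp_apply, gram_apply, frame_coord_of_mem hq,
      (isInvertible_inner g q).self_apply_inverse]
    simp [coord_frame_of_mem hq]
  · ext v
    have h : ContinuousLinearMap.precomp ℝ (coord I p q) (gram g p q v) =
        g.inner q (frame I p q v) := by
      ext w
      simp [gram_apply, frame_coord_of_mem hq]
    simp only [ContinuousLinearMap.comp_apply]
    rw [h, (isInvertible_inner g q).inverse_apply_self]
    simp [coord_frame_of_mem hq]

theorem isInvertible_gram [FiniteDimensional ℝ E] (g : SmoothMetric I M) (p : M) :
    (gram g p p).IsInvertible :=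
  isInvertible_gram_of_mem g (mem_chart_source H p)

theorem mdifferentiableAt_gram (g : SmoothMetric I M) (p : M) :
    MDifferentiableAt I 𝓘(ℝ, E →L[ℝ] E →L[ℝ] ℝ) (gram g p) p := by
  have h1 := (g.contMDiff p)
  rw [contMDiffAt_section] at h1
  refine (h1.mdifferentiableAt (by simp)).congr_of_eventuallyEq ?_
  filter_upwards [(chartAt H p).open_source.mem_nhds (mem_chart_source H p)] with q hq
  ext v w
  rw [hom_trivializationAt_apply]
  rw [inCoordinates_apply_eq₂ hq hq (by simp)]
  have hs : ∀ v : E, frame I p q v =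
      (trivializationAt E (TangentSpace I : M → Type _) p).symm q v := fun v =>
    Trivialization.symmL_apply _ hq v
  rw [gram_apply, hs, hs]
  simp

/-- Koszul's formula for a coordinate frame, where all brackets vanish. -/
theorem gram_christoffel [FiniteDimensional ℝ E] (g : SmoothMetric I M) (p : M) (u v z : E) :
    gram g p p (christoffel g p v u) z =
      (gramDeriv g p u v z + gramDeriv g p v u z - gramDeriv g p z v u) / 2 := by
  simp only [christoffel, ContinuousLinearMap.comp_apply,
    (isInvertible_gram g p).self_apply_inverse]
  simp
  ring

theorem gramDeriv_apply (g : SmoothMetric I M) (p : M) (u v w : E) :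
    gramDeriv g p u v w = mvfderiv I (fun q => gram g p q v w) p (frame I p p u) := by
  have h := mdifferentiableAt_gram g p
  rw [mvfderiv_clm_apply_const (h.clm_apply mdifferentiableAt_const),
    mvfderiv_clm_apply_const h]
  rfl

theorem gramDeriv_symm (g : SmoothMetric I M) (p : M) (u v w : E) :
    gramDeriv g p u v w = gramDeriv g p u w v := by
  simp only [gramDeriv_apply, gram_symm g p _ v w]

end Coordinates
end SubmanifoldGeometry

/-! ### Symmetry, metric compatibility and the connection along a map. -/

namespace SubmanifoldGeometry

section Pullback

variable {E : Type*} [NormedAddCommGroup E] [NormedSpace ℝ E]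
  {H : Type*} [TopologicalSpace H] {I : ModelWithCorners ℝ E H} [I.Boundaryless]
  {M : Type*} [TopologicalSpace M] [ChartedSpace H M] [IsManifold I ∞ M]
  {F : Type*} [NormedAddCommGroup F] [NormedSpace ℝ F]

theorem christoffel_symm [FiniteDimensional ℝ E] (g : SmoothMetric I M) (p : M) (u v : E) :
    christoffel g p v u = christoffel g p u v := by
  apply (isInvertible_gram g p).injective
  ext z
  rw [gram_christoffel, gram_christoffel, gramDeriv_symm g p z v u]
  ring

/-- Metric compatibility in coordinates: in the sum of the two Koszul expressions the terms other
than `∂_u` cancel. -/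
theorem gram_christoffel_add [FiniteDimensional ℝ E] (g : SmoothMetric I M) (p : M) (u v w : E) :
    gram g p p (christoffel g p v u) w + gram g p p v (christoffel g p w u) =
      gramDeriv g p u v w := by
  rw [gram_symm g p p v, gram_christoffel, gram_christoffel, gramDeriv_symm g p u w v,
    gramDeriv_symm g p w v u, gramDeriv_symm g p v w u]
  ring

theorem mvfderiv_comp_frame_eventuallyEq {p : M} {φ : M → F}
    (hφ : ContMDiffAt I 𝓘(ℝ, F) ∞ φ p) :
    (fun q => (mvfderiv I φ q ∘L frame I p q : E →L[ℝ] F)) =ᶠ[𝓝 p]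
      fun q => fderiv ℝ (φ ∘ (extChartAt I p).symm) (extChartAt I p q) := by
  -- A finite order of smoothness is lowered to on purpose: `C^1` at a point persists on a
  -- neighbourhood, while for `∞` the neighbourhood may shrink with the order.
  have h1 : ContMDiffAt I 𝓘(ℝ, F) 1 φ p := hφ.of_le (by norm_cast)
  filter_upwards [(chartAt H p).open_source.mem_nhds (mem_chart_source H p),
    contMDiffAt_iff_contMDiffAt_nhds (by simp) |>.1 h1] with q hq h
  ext w
  exact mvfderiv_frame hq (h.mdifferentiableAt one_ne_zero) w

theorem contDiffAt_comp_extChartAt_symm {p : M} {φ : M → F}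
    (hφ : ContMDiffAt I 𝓘(ℝ, F) ∞ φ p) :
    ContDiffAt ℝ ∞ (φ ∘ (extChartAt I p).symm) (extChartAt I p p) := by
  have := (contMDiffAt_iff.1 hφ).2
  rwa [I.range_eq_univ, contDiffWithinAt_univ] at this

theorem differentiableAt_fderiv_comp_extChartAt_symm {p : M} {φ : M → F}
    (hφ : ContMDiffAt I 𝓘(ℝ, F) ∞ φ p) :
    DifferentiableAt ℝ (fderiv ℝ (φ ∘ (extChartAt I p).symm)) (extChartAt I p p) :=
  ((contDiffAt_comp_extChartAt_symm hφ).fderiv_right (m := 1) (by norm_cast)).differentiableAt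
    one_ne_zero

theorem mdifferentiableAt_mvfderiv_comp_frame {p : M} {φ : M → F}
    (hφ : ContMDiffAt I 𝓘(ℝ, F) ∞ φ p) :
    MDifferentiableAt I 𝓘(ℝ, E →L[ℝ] F)
      (fun q => (mvfderiv I φ q ∘L frame I p q : E →L[ℝ] F)) p :=
  ((differentiableAt_fderiv_comp_extChartAt_symm hφ).mdifferentiableAt.comp p
    (mdifferentiableAt_extChartAt (mem_chart_source H p))).congr_of_eventuallyEq
    (mvfderiv_comp_frame_eventuallyEq hφ)

/-- Reduces the derivative of the Jacobian to a second Fréchet derivative, whose symmetry will give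
the absence of torsion. -/
theorem mvfderiv_mvfderiv_comp_frame {p : M} {φ : M → F}
    (hφ : ContMDiffAt I 𝓘(ℝ, F) ∞ φ p) (u : TangentSpace I p) :
    mvfderiv I (fun q => (mvfderiv I φ q ∘L frame I p q : E →L[ℝ] F)) p u =
      fderiv ℝ (fderiv ℝ (φ ∘ (extChartAt I p).symm)) (extChartAt I p p) (coord I p p u) := by
  rw [mvfderiv_eq_fderiv (mdifferentiableAt_mvfderiv_comp_frame hφ)]
  congr 1
  apply Filter.EventuallyEq.fderiv_eq
  have hc : Filter.Tendsto (extChartAt I p).symm (𝓝 (extChartAt I p p)) (𝓝 p) := by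
    have := continuousAt_extChartAt_symm (I := I) p
    rwa [ContinuousAt, (extChartAt I p).left_inv (mem_extChartAt_source p)] at this
  filter_upwards [hc.eventually (mvfderiv_comp_frame_eventuallyEq hφ),
    extChartAt_target_mem_nhds (I := I) p] with y hy hy'
  simp only [Function.comp_apply] at hy ⊢
  rw [hy, (extChartAt I p).right_inv hy']

/-- The symmetry of the Hessian of a function in the coordinates at `p`. -/
theorem mvfderiv_mvfderiv_comp_frame_symm {p : M} {φ : M → F}
    (hφ : ContMDiffAt I 𝓘(ℝ, F) ∞ φ p) (u v : TangentSpace I p) :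
    mvfderiv I (fun q => (mvfderiv I φ q ∘L frame I p q : E →L[ℝ] F)) p u (coord I p p v) =
      mvfderiv I (fun q => (mvfderiv I φ q ∘L frame I p q : E →L[ℝ] F)) p v (coord I p p u) := by
  rw [mvfderiv_mvfderiv_comp_frame hφ, mvfderiv_mvfderiv_comp_frame hφ]
  exact (contDiffAt_comp_extChartAt_symm hφ).isSymmSndFDerivAt (by simp; norm_cast) _ _

variable {E' : Type*} [NormedAddCommGroup E'] [NormedSpace ℝ E']
  {H' : Type*} [TopologicalSpace H'] {J : ModelWithCorners ℝ E' H'} [J.Boundaryless]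
  {N : Type*} [TopologicalSpace N] [ChartedSpace H' N] [IsManifold J ∞ N]

/-- The components are constant near `P`, so only the Christoffel term is left. -/
theorem leviCivita_frame (h : SmoothMetric J N) (P : N) (w : E') (v : TangentSpace J P) :
    leviCivita h (fun y => frame J P y w) P v =
      frame J P P (christoffel h P w (coord J P P v)) := by
  have h0 : mvfderiv J (fun q => coord J P q (frame J P q w)) P = 0 := by
    have : (fun q => coord J P q (frame J P q w)) =ᶠ[𝓝 P] fun _ => w := by
      filter_upwards [(chartAt H' P).open_source.mem_nhds (mem_chart_source H' P)] with q hq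
      exact coord_frame_of_mem hq w
    have h2 := this.mfderiv_eq (I := J) (I' := 𝓘(ℝ, E'))
    have h3 := mvfderiv_const (I := J) w (x := P)
    ext v
    have h4 := congrArg (fun A => A v) h3
    have h5 := congrArg (fun A : E' →L[ℝ] E' => A v) h2
    exact h5.trans h4
  change frame J P P (mvfderiv J (fun q => coord J P q (frame J P q w)) P v +
    christoffel h P (coord J P P (frame J P P w)) (coord J P P v)) = _
  rw [h0, coord_frame]
  simp

theorem coord_pullbackDerivative (h : SmoothMetric J N) (x : M → N)
    (W : ∀ q : M, TangentSpace J (x q)) (p : M) (u : TangentSpace I p) :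
    coord J (x p) (x p) (pullbackDerivative (leviCivita h) x W p u) =
      mvfderiv I (fun q => coord J (x p) (x q) (W q)) p u +
        christoffel h (x p) (coord J (x p) (x p) (W p))
          (coord J (x p) (x p) (mfderiv I J x p u)) := by
  have : pullbackDerivative (leviCivita h) x W p u =
    frame J (x p) (x p) (mvfderiv I (fun q => coord J (x p) (x q) (W q)) p u) +
    leviCivita h (fun y => frame J (x p) y (coord J (x p) (x p) (W p))) (x p)
      (mfderiv I J x p u) := rfl
  rw [this, leviCivita_frame, map_add, coord_frame, coord_frame]

theorem eventually_mem_chart_source {x : M → N} {p : M} (hx : ContinuousAt x p) :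
    ∀ᶠ q in 𝓝 p, x q ∈ (chartAt H' (x p)).source :=
  hx.preimage_mem_nhds ((chartAt H' (x p)).open_source.mem_nhds (mem_chart_source H' (x p)))

/-- The Levi-Civita connection acting on fields along a map is compatible with the metric. -/
theorem mvfderiv_inner [FiniteDimensional ℝ E'] (h : SmoothMetric J N) {x : M → N} {p : M}
    (hx : MDifferentiableAt I J x p) {W W' : ∀ q : M, TangentSpace J (x q)}
    (hW : MDifferentiableAt I 𝓘(ℝ, E') (fun q => coord J (x p) (x q) (W q)) p)
    (hW' : MDifferentiableAt I 𝓘(ℝ, E') (fun q => coord J (x p) (x q) (W' q)) p)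
    (u : TangentSpace I p) :
    mvfderiv I (fun q => h.inner (x q) (W q) (W' q)) p u =
      h.inner (x p) (pullbackDerivative (leviCivita h) x W p u) (W' p) +
        h.inner (x p) (W p) (pullbackDerivative (leviCivita h) x W' p u) := by
  have he : (fun q => h.inner (x q) (W q) (W' q)) =ᶠ[𝓝 p]
      fun q => gram h (x p) (x q) (coord J (x p) (x q) (W q)) (coord J (x p) (x q) (W' q)) := by
    filter_upwards [eventually_mem_chart_source (H' := H') hx.continuousAt] with q hq
    exact inner_eq_gram_coord h hq _ _
  have he' := congrArg (fun A : E →L[ℝ] ℝ => A u) (he.mfderiv_eq (I := I) (I' := 𝓘(ℝ, ℝ)))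
  refine Eq.trans he' ?_
  have hG := mdifferentiableAt_gram h (x p)
  have hGx : MDifferentiableAt I 𝓘(ℝ, E' →L[ℝ] E' →L[ℝ] ℝ) (fun q => gram h (x p) (x q)) p :=
    hG.comp p hx
  have hd : mvfderiv I (fun q => gram h (x p) (x q)) p u =
      gramDeriv h (x p) (coord J (x p) (x p) (mfderiv I J x p u)) := by
    simp only [gramDeriv, ContinuousLinearMap.comp_apply, frame_coord]
    exact mfderiv_comp_apply (x := p) hG hx u
  refine (mvfderiv_clm_apply (hGx.clm_apply hW) hW' u).trans ?_
  rw [mvfderiv_clm_apply hGx hW, hd, inner_eq_gram_coord h (mem_chart_source H' (x p)),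
    inner_eq_gram_coord h (mem_chart_source H' (x p)), coord_pullbackDerivative,
    coord_pullbackDerivative]
  -- The derivative of the metric coefficients is exactly what the two Christoffel terms contribute.
  simp only [map_add, add_apply, ← gram_christoffel_add]
  ring

end Pullback

/-! ### The Gauss and Weingarten formulas. -/

namespace IsometricImmersion

variable {E : Type*} [NormedAddCommGroup E] [NormedSpace ℝ E]
  {H : Type*} [TopologicalSpace H] {I : ModelWithCorners ℝ E H} [I.Boundaryless]
  {M : Type*} [TopologicalSpace M] [ChartedSpace H M] [IsManifold I ∞ M]
  {E' : Type*} [NormedAddCommGroup E'] [NormedSpace ℝ E']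
  {H' : Type*} [TopologicalSpace H'] {J : ModelWithCorners ℝ E' H'} [J.Boundaryless]
  {N : Type*} [TopologicalSpace N] [ChartedSpace H' N] [IsManifold J ∞ N]
  {g : SmoothMetric I M} {h : SmoothMetric J N} (x : IsometricImmersion g h)

theorem contMDiffAt_extChartAt_comp (p : M) :
    ContMDiffAt I 𝓘(ℝ, E') ∞ (extChartAt J (x.toFun p) ∘ x.toFun) p :=
  contMDiffAt_extChartAt.comp p (x.contMDiff_toFun p)

theorem mdifferentiableAt_toFun (p : M) : MDifferentiableAt I J x.toFun p :=
  (x.contMDiff_toFun p).mdifferentiableAt (by simp)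

/-- Taking components is applying the differential of the chart. This turns `dx` into the Jacobian
of a vector-valued map, to which the product rule and the symmetry of the Hessian apply. -/
theorem coord_differential {p q : M} (hq : x.toFun q ∈ (chartAt H' (x.toFun p)).source)
    (v : TangentSpace I q) :
    coord J (x.toFun p) (x.toFun q) (x.differential q v) =
      mvfderiv I (extChartAt J (x.toFun p) ∘ x.toFun) q v := by
  have h1 := mfderiv_comp_apply (x := q) (mdifferentiableAt_extChartAt (I := J) hq)
    (x.mdifferentiableAt_toFun q) v
  refine Eq.trans ?_ h1.symm
  rw [coord, TangentBundle.continuousLinearMapAt_trivializationAt hq]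
  rfl

theorem coord_differential_eventuallyEq (p : M) (T : ∀ q : M, TangentSpace I q) :
    (fun q => coord J (x.toFun p) (x.toFun q) (x.differential q (T q))) =ᶠ[𝓝 p]
      fun q => (mvfderiv I (extChartAt J (x.toFun p) ∘ x.toFun) q ∘L frame I p q : E →L[ℝ] E')
        (coord I p q (T q)) := by
  filter_upwards [eventually_mem_chart_source (H' := H') (x.contMDiff_toFun.continuous.continuousAt (x := p)),
    (chartAt H p).open_source.mem_nhds (mem_chart_source H p)] with q hq hq'
  rw [x.coord_differential hq, ContinuousLinearMap.comp_apply, frame_coord_of_mem hq']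

theorem mdifferentiableAt_coord_differential_of_coord {p : M} {T : ∀ q : M, TangentSpace I q}
    (hT : MDifferentiableAt I 𝓘(ℝ, E) (fun q => coord I p q (T q)) p) :
    MDifferentiableAt I 𝓘(ℝ, E')
      (fun q => coord J (x.toFun p) (x.toFun q) (x.differential q (T q))) p :=
  ((mdifferentiableAt_mvfderiv_comp_frame (x.contMDiffAt_extChartAt_comp p)).clm_apply
    hT).congr_of_eventuallyEq (x.coord_differential_eventuallyEq p T)

theorem mvfderiv_coord_differential {p : M} {T : ∀ q : M, TangentSpace I q}
    (hT : MDifferentiableAt I 𝓘(ℝ, E) (fun q => coord I p q (T q)) p) (u : TangentSpace I p) :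
    mvfderiv I (fun q => coord J (x.toFun p) (x.toFun q) (x.differential q (T q))) p u =
      mvfderiv I (fun q => (mvfderiv I (extChartAt J (x.toFun p) ∘ x.toFun) q ∘L
        frame I p q : E →L[ℝ] E')) p u (coord I p p (T p)) +
      coord J (x.toFun p) (x.toFun p)
        (x.differential p (frame I p p (mvfderiv I (fun q => coord I p q (T q)) p u))) := by
  have he := congrArg (fun A : E →L[ℝ] E' => A u)
    ((x.coord_differential_eventuallyEq p T).mfderiv_eq (I := I) (I' := 𝓘(ℝ, E')))
  refine Eq.trans he ?_
  refine (mvfderiv_clm_apply (mdifferentiableAt_mvfderiv_comp_frame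
    (x.contMDiffAt_extChartAt_comp p)) hT u).trans ?_
  rw [x.coord_differential (mem_chart_source H' (x.toFun p))]
  rfl

theorem injective_coord (P : N) : Function.Injective (coord J P P) :=
  Function.LeftInverse.injective (frame_coord P)

theorem mdifferentiableAt_coord_frame (p : M) (w : E) :
    MDifferentiableAt I 𝓘(ℝ, E) (fun q => coord I p q (frame I p q w)) p :=
  mdifferentiableAt_coord (mdifferentiableAt_frame p w)

theorem mvfderiv_coord_frame (p : M) (w : E) (u : TangentSpace I p) :
    mvfderiv I (fun q => coord I p q (frame I p q w)) p u = 0 := by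
  have : (fun q => coord I p q (frame I p q w)) =ᶠ[𝓝 p] fun _ => w := by
    filter_upwards [(chartAt H p).open_source.mem_nhds (mem_chart_source H p)] with q hq
    exact coord_frame_of_mem hq w
  have h2 := this.mfderiv_eq (I := I) (I' := 𝓘(ℝ, E))
  have h4 := congrArg (fun A => A u) (mvfderiv_const (I := I) w (x := p))
  have h5 := congrArg (fun A : E →L[ℝ] E => A u) h2
  exact h5.trans h4

/-- The Hessian and Christoffel terms see only `T p`, so replacing `T` by its constant-component
extension changes the derivative only by `dx` of the derivative of the components. That change is
tangent, which is why `α` depends only on values at `p`. -/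
theorem covariantDerivative_differential {p : M} {T : ∀ q : M, TangentSpace I q}
    (hT : MDifferentiableAt I 𝓘(ℝ, E) (fun q => coord I p q (T q)) p) (u : TangentSpace I p) :
    x.covariantDerivative (fun q => x.differential q (T q)) p u =
      x.covariantDerivative (fun q => x.differential q (frame I p q (coord I p p (T p)))) p u +
      x.differential p (frame I p p (mvfderiv I (fun q => coord I p q (T q)) p u)) := by
  apply injective_coord
  simp only [covariantDerivative]
  rw [map_add, coord_pullbackDerivative, coord_pullbackDerivative,
    x.mvfderiv_coord_differential hT,
    x.mvfderiv_coord_differential (mdifferentiableAt_coord_frame p _), mvfderiv_coord_frame]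
  simp only [frame_coord, map_zero]
  abel

/-- The induced connection is torsion-free. -/
theorem covariantDerivative_frame_symm [FiniteDimensional ℝ E'] (p : M)
    (u v : TangentSpace I p) :
    x.covariantDerivative (fun q => x.differential q (frame I p q (coord I p p v))) p u =
      x.covariantDerivative (fun q => x.differential q (frame I p q (coord I p p u))) p v := by
  apply injective_coord
  simp only [covariantDerivative]
  rw [coord_pullbackDerivative, coord_pullbackDerivative,
    x.mvfderiv_coord_differential (mdifferentiableAt_coord_frame p _),
    x.mvfderiv_coord_differential (mdifferentiableAt_coord_frame p _), mvfderiv_coord_frame,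
    mvfderiv_coord_frame, christoffel_symm]
  simp only [frame_coord, map_zero, add_zero]
  congr 1
  exact mvfderiv_mvfderiv_comp_frame_symm (x.contMDiffAt_extChartAt_comp p) u v

/-- Because `x` is isometric, the coefficients of `g` are inner products of fields along `x`, and
metric compatibility differentiates them. -/
theorem gramDeriv_eq_inner_covariantDerivative [FiniteDimensional ℝ E'] (p : M)
    (u v w : TangentSpace I p) :
    gramDeriv g p (coord I p p u) (coord I p p v) (coord I p p w) =
      h.inner (x.toFun p)
        (x.covariantDerivative (fun q => x.differential q (frame I p q (coord I p p v))) p u)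
        (x.differential p w) +
      h.inner (x.toFun p)
        (x.covariantDerivative (fun q => x.differential q (frame I p q (coord I p p w))) p u)
        (x.differential p v) := by
  have h1 := mvfderiv_inner h (x.mdifferentiableAt_toFun p)
    (x.mdifferentiableAt_coord_differential p (coord I p p v))
    (x.mdifferentiableAt_coord_differential p (coord I p p w)) u
  rw [gramDeriv_apply, frame_coord]
  have h2 : (fun q => gram g p q (coord I p p v) (coord I p p w)) =
      fun q => h.inner (x.toFun q) (x.differential q (frame I p q (coord I p p v)))
        (x.differential q (frame I p q (coord I p p w))) := by
    ext q
    exact (x.isometric q _ _).symm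
  rw [h2, h1, frame_coord, frame_coord, h.symm (x.toFun p) (x.differential p v)]
  rfl

/-- Koszul's argument: expand the three metric derivatives; by vanishing torsion everything cancels
except twice the left-hand side. -/
theorem inner_covariantDerivative_frame [FiniteDimensional ℝ E] [FiniteDimensional ℝ E'] (p : M)
    (u v w : TangentSpace I p) :
    h.inner (x.toFun p)
        (x.covariantDerivative (fun q => x.differential q (frame I p q (coord I p p v))) p u)
        (x.differential p w) =
      gram g p p (christoffel g p (coord I p p v) (coord I p p u)) (coord I p p w) := by
  rw [gram_christoffel, x.gramDeriv_eq_inner_covariantDerivative,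
    x.gramDeriv_eq_inner_covariantDerivative, x.gramDeriv_eq_inner_covariantDerivative,
    x.covariantDerivative_frame_symm p v u, x.covariantDerivative_frame_symm p w v,
    x.covariantDerivative_frame_symm p w u]
  ring

/-- The tangential part of the Gauss formula. -/
theorem inner_covariantDerivative_differential [FiniteDimensional ℝ E] [FiniteDimensional ℝ E']
    {p : M} {T : ∀ q : M, TangentSpace I q}
    (hT : MDifferentiableAt I 𝓘(ℝ, E) (fun q => coord I p q (T q)) p) (u w : TangentSpace I p) :
    h.inner (x.toFun p) (x.covariantDerivative (fun q => x.differential q (T q)) p u)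
        (x.differential p w) = g.inner p (leviCivita g T p u) w := by
  rw [x.covariantDerivative_differential hT, map_add, add_apply,
    x.inner_covariantDerivative_frame]
  have h1 : leviCivita g T p u = frame I p p (mvfderiv I (fun q => coord I p q (T q)) p u +
    christoffel g p (coord I p p (T p)) (coord I p p u)) := rfl
  have h2 := x.isometric p (frame I p p (mvfderiv I (fun q => coord I p q (T q)) p u)) w
  refine (congrArg (_ + ·) h2).trans ?_
  rw [h1, map_add, map_add, add_apply, gram_apply, frame_coord, add_comm]

theorem injective_inner [FiniteDimensional ℝ E] (g : SmoothMetric I M) {p : M}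
    {v w : TangentSpace I p} (hvw : ∀ z, g.inner p v z = g.inner p w z) : v = w :=
  (isInvertible_inner g p).injective (by ext z; exact hvw z)

theorem tangentPart_covariantDerivative_differential [FiniteDimensional ℝ E]
    [FiniteDimensional ℝ E'] {p : M} {T : ∀ q : M, TangentSpace I q}
    (hT : MDifferentiableAt I 𝓘(ℝ, E) (fun q => coord I p q (T q)) p) (u : TangentSpace I p) :
    x.tangentPart p (x.covariantDerivative (fun q => x.differential q (T q)) p u) =
      leviCivita g T p u :=
  injective_inner g fun z => by
    rw [x.inner_tangentPart, x.inner_covariantDerivative_differential hT]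

theorem tangentPart_differential [FiniteDimensional ℝ E] (p : M) (v : TangentSpace I p) :
    x.tangentPart p (x.differential p v) = v :=
  injective_inner g fun z => by
    rw [x.inner_tangentPart]
    exact x.isometric p v z

theorem normalPart_differential [FiniteDimensional ℝ E] (p : M) (v : TangentSpace I p) :
    x.normalPart p (x.differential p v) = 0 := by
  simp [normalPart, x.tangentPart_differential]

theorem tangentPart_eq_zero [FiniteDimensional ℝ E] {p : M} {ξ : TangentSpace J (x.toFun p)}
    (hξ : ∀ v, h.inner (x.toFun p) ξ (x.differential p v) = 0) : x.tangentPart p ξ = 0 :=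
  injective_inner g fun z => by rw [x.inner_tangentPart, hξ]; simp

theorem normalPart_eq_self [FiniteDimensional ℝ E] {p : M} {ξ : TangentSpace J (x.toFun p)}
    (hξ : ∀ v, h.inner (x.toFun p) ξ (x.differential p v) = 0) : x.normalPart p ξ = ξ := by
  simp [normalPart, x.tangentPart_eq_zero hξ]

theorem secondFundamentalForm_apply [FiniteDimensional ℝ E] (p : M) (u v : TangentSpace I p) :
    x.secondFundamentalForm p u v = x.normalPart p
      (x.covariantDerivative (fun q => x.differential q (frame I p q (coord I p p v))) p u) := rfl

theorem normalPart_covariantDerivative_differential [FiniteDimensional ℝ E]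
    {p : M} {T : ∀ q : M, TangentSpace I q}
    (hT : MDifferentiableAt I 𝓘(ℝ, E) (fun q => coord I p q (T q)) p) (u : TangentSpace I p) :
    x.normalPart p (x.covariantDerivative (fun q => x.differential q (T q)) p u) =
      x.secondFundamentalForm p u (T p) := by
  rw [x.covariantDerivative_differential hT, map_add, x.normalPart_differential, add_zero,
    x.secondFundamentalForm_apply]

/-- The tangential part of the Weingarten formula. -/
theorem tangentPart_covariantDerivative_normal [FiniteDimensional ℝ E] [FiniteDimensional ℝ E']
    {p : M} {ξ : ∀ q : M, TangentSpace J (x.toFun q)}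
    (hd : MDifferentiableAt I 𝓘(ℝ, E') (fun q => coord J (x.toFun p) (x.toFun q) (ξ q)) p)
    (hξ : ∀ q v, h.inner (x.toFun q) (ξ q) (x.differential q v) = 0) (u : TangentSpace I p) :
    x.tangentPart p (x.covariantDerivative ξ p u) = - x.weingarten p (ξ p) u := by
  refine injective_inner g fun z => ?_
  rw [x.inner_tangentPart, map_neg, neg_apply, x.inner_weingarten]
  -- Differentiate `⟨ξ, dx Z⟩ = 0`, with `Z` the constant-component extension of `z`.
  have h1 := mvfderiv_inner h (x.mdifferentiableAt_toFun p) hd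
    (x.mdifferentiableAt_coord_differential p (coord I p p z)) u
  simp only [hξ, frame_coord] at h1
  have h0 : mvfderiv I (fun _ : M => (0 : ℝ)) p u = 0 := by rw [mvfderiv_const]; rfl
  rw [h0] at h1
  have h2 := x.differential_tangentPart_add_normalPart p
    (x.covariantDerivative (fun q => x.differential q (frame I p q (coord I p p z))) p u)
  rw [← x.secondFundamentalForm_apply] at h2
  have h3 : h.inner (x.toFun p) (ξ p)
      (x.covariantDerivative (fun q => x.differential q (frame I p q (coord I p p z))) p u) =
      h.inner (x.toFun p) (x.secondFundamentalForm p u z) (ξ p) := by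
    rw [← h2, map_add, hξ, zero_add, h.symm]
  rw [← h3]
  exact eq_neg_of_add_eq_zero_left h1.symm

/-- The normal and tangential parts of the derivative of a field that is a combination of a
tangent vector and of the field itself. -/
theorem gauss_weingarten_of_covariantDerivative_eq [FiniteDimensional ℝ E]
    [FiniteDimensional ℝ E'] {p : M} {T : ∀ q : M, TangentSpace I q}
    (hT : MDifferentiableAt I 𝓘(ℝ, E) (fun q => coord I p q (T q)) p)
    {ξ : ∀ q : M, TangentSpace J (x.toFun q)}
    (hd : MDifferentiableAt I 𝓘(ℝ, E') (fun q => coord J (x.toFun p) (x.toFun q) (ξ q)) p)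
    (hξ : ∀ q v, h.inner (x.toFun q) (ξ q) (x.differential q v) = 0) (u : TangentSpace I p)
    {c a : ℝ} (hV : x.covariantDerivative (fun q => x.differential q (T q) + ξ q) p u =
      c • (x.differential p u - a • (x.differential p (T p) + ξ p))) :
    x.secondFundamentalForm p u (T p) + x.normalConnection ξ p u = (-c * a) • ξ p ∧
      leviCivita g T p u - x.weingarten p (ξ p) u = c • (u - a • T p) := by
  rw [covariantDerivative, pullbackDerivative_add _ _
    (x.mdifferentiableAt_coord_differential_of_coord hT) hd] at hV
  replace hV : x.covariantDerivative (fun q => x.differential q (T q)) p u +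
    x.covariantDerivative ξ p u = _ := hV
  constructor
  · have h1 := congrArg (x.normalPart p) hV
    rw [map_add, x.normalPart_covariantDerivative_differential hT, map_smul, map_sub, map_smul,
      map_add, x.normalPart_differential, x.normalPart_differential,
      x.normalPart_eq_self (hξ p), zero_add, zero_sub, smul_neg, smul_smul, ← neg_smul,
      ← neg_mul] at h1
    exact h1
  · have h1 := congrArg (x.tangentPart p) hV
    rw [map_add, x.tangentPart_covariantDerivative_differential hT,
      x.tangentPart_covariantDerivative_normal hd hξ, map_smul, map_sub, map_smul,
      map_add, x.tangentPart_differential, x.tangentPart_differential,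
      x.tangentPart_eq_zero (hξ p), add_zero, ← sub_eq_add_neg] at h1
    exact h1

end IsometricImmersion
end SubmanifoldGeometry

/-! ### Regularity of gradients. -/

namespace SubmanifoldGeometry

section Gradient

variable {E : Type*} [NormedAddCommGroup E] [NormedSpace ℝ E] [FiniteDimensional ℝ E]
  {H : Type*} [TopologicalSpace H] {I : ModelWithCorners ℝ E H} [I.Boundaryless]
  {M : Type*} [TopologicalSpace M] [ChartedSpace H M] [IsManifold I ∞ M]

/-- The gradient of a smooth function is a differentiable vector field. -/
theorem mdifferentiableAt_coord_gradient (g : SmoothMetric I M) {p : M} {φ : M → ℝ}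
    (hφ : ContMDiffAt I 𝓘(ℝ, ℝ) ∞ φ p) {T : ∀ q : M, TangentSpace I q}
    (hT : ∀ q w, g.inner q (T q) w = mvfderiv I φ q w) :
    MDifferentiableAt I 𝓘(ℝ, E) (fun q => coord I p q (T q)) p := by
  have : CompleteSpace E := FiniteDimensional.complete ℝ E
  obtain ⟨e, he⟩ := isInvertible_gram g p
  -- In coordinates the gradient is the inverse Gram matrix applied to `dφ`, and inversion is
  -- differentiable at invertible operators.
  have h1 : DifferentiableAt ℝ (ContinuousLinearMap.inverse :
      (E →L[ℝ] E →L[ℝ] ℝ) → ((E →L[ℝ] ℝ) →L[ℝ] E)) (gram g p p) := by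
    rw [← he]
    exact (contDiffAt_map_inverse (n := 1) e).differentiableAt one_ne_zero
  have h2 : MDifferentiableAt I 𝓘(ℝ, (E →L[ℝ] ℝ) →L[ℝ] E)
      (fun q => (gram g p q).inverse) p :=
    h1.mdifferentiableAt.comp p (mdifferentiableAt_gram g p)
  refine (h2.clm_apply (mdifferentiableAt_mvfderiv_comp_frame hφ)).congr_of_eventuallyEq ?_
  filter_upwards [(chartAt H p).open_source.mem_nhds (mem_chart_source H p)] with q hq
  have h3 : (mvfderiv I φ q ∘L frame I p q : E →L[ℝ] ℝ) = gram g p q (coord I p q (T q)) := by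
    ext w
    rw [gram_apply, frame_coord_of_mem hq, hT]
    rfl
  rw [h3, (isInvertible_gram_of_mem g hq).inverse_apply_self]

end Gradient

/-! ### The warped product in product charts. -/

section Warped

variable {U : TopologicalSpace.Opens ℝ} {n : ℕ}

theorem Cylinder.mvfderiv_height_frame {P q : Cylinder U n}
    (hq : q ∈ (chartAt (ModelProd ℝ (EuclideanSpace ℝ (Fin n))) P).source)
    (z : ℝ × EuclideanSpace ℝ (Fin n)) :
    mvfderiv (𝓘(ℝ, ℝ).prod (𝓡 n)) Cylinder.height q (frame (𝓘(ℝ, ℝ).prod (𝓡 n)) P q z) = z.1 := by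
  rw [mvfderiv_frame hq (Cylinder.contMDiff_height.mdifferentiable (by simp) q)]
  have hq' : q ∈ (extChartAt (𝓘(ℝ, ℝ).prod (𝓡 n)) P).source := by rwa [extChartAt_source]
  have h : (Cylinder.height ∘ (extChartAt (𝓘(ℝ, ℝ).prod (𝓡 n)) P).symm) =ᶠ[𝓝
      (extChartAt (𝓘(ℝ, ℝ).prod (𝓡 n)) P q)] Prod.fst := by
    filter_upwards [extChartAt_target_mem_nhds' ((extChartAt (𝓘(ℝ, ℝ).prod (𝓡 n)) P).map_source hq')] with y hy
    rw [extChartAt_prod] at hy ⊢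
    exact (extChartAt 𝓘(ℝ, ℝ) P.1).right_inv hy.1
  rw [h.fderiv_eq, fderiv_fst]
  rfl

/-- The inverse of the chart of `S^n` at `s`, as a parametrization in `ℝ^(n+1)`. -/
noncomputable def sphereParam (s : Metric.sphere (0 : EuclideanSpace ℝ (Fin (n + 1))) 1) :
    EuclideanSpace ℝ (Fin n) → EuclideanSpace ℝ (Fin (n + 1)) :=
  Subtype.val ∘ (extChartAt (𝓡 n) s).symm

theorem Cylinder.mvfderiv_spherical_frame {P q : Cylinder U n}
    (hq : q ∈ (chartAt (ModelProd ℝ (EuclideanSpace ℝ (Fin n))) P).source)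
    (z : ℝ × EuclideanSpace ℝ (Fin n)) :
    mvfderiv (𝓘(ℝ, ℝ).prod (𝓡 n)) Cylinder.spherical q (frame (𝓘(ℝ, ℝ).prod (𝓡 n)) P q z) =
      fderiv ℝ (sphereParam P.2) (extChartAt (𝓡 n) P.2 q.2) z.2 := by
  have : Fact (finrank ℝ (EuclideanSpace ℝ (Fin (n + 1))) = n + 1) := ⟨finrank_euclideanSpace_fin⟩
  rw [mvfderiv_frame hq (Cylinder.contMDiff_spherical.mdifferentiable (by simp) q)]
  have h1 : (Cylinder.spherical ∘ (extChartAt (𝓘(ℝ, ℝ).prod (𝓡 n)) P).symm) =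
      sphereParam P.2 ∘ Prod.snd := by
    rw [extChartAt_prod]
    rfl
  have hq2 : q.2 ∈ (chartAt (EuclideanSpace ℝ (Fin n)) P.2).source := by
    rw [prodChartedSpace_chartAt] at hq
    exact hq.2
  have h2 : DifferentiableAt ℝ (sphereParam P.2) (extChartAt (𝓡 n) P.2 q.2) :=
    differentiableAt_comp_extChartAt_symm_of_mem hq2
      ((contMDiff_coe_sphere (m := 1) q.2).mdifferentiableAt one_ne_zero)
  have h3 : extChartAt (𝓘(ℝ, ℝ).prod (𝓡 n)) P q =
      (extChartAt 𝓘(ℝ, ℝ) P.1 q.1, extChartAt (𝓡 n) P.2 q.2) := by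
    rw [extChartAt_prod]
    rfl
  have h4 : HasFDerivAt (sphereParam P.2 ∘ Prod.snd)
      (fderiv ℝ (sphereParam P.2) (extChartAt (𝓡 n) P.2 q.2) ∘L ContinuousLinearMap.snd ℝ ℝ
        (EuclideanSpace ℝ (Fin n)))
      (extChartAt (𝓘(ℝ, ℝ).prod (𝓡 n)) P q : ℝ × EuclideanSpace ℝ (Fin n)) := by
    rw [h3]
    exact HasFDerivAt.comp (g := sphereParam P.2) (f := Prod.snd)
      ((extChartAt 𝓘(ℝ, ℝ) P.1 q.1 : ℝ), (extChartAt (𝓡 n) P.2 q.2 : EuclideanSpace ℝ (Fin n)))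
      h2.hasFDerivAt hasFDerivAt_snd
  rw [h1, h4.fderiv]
  rfl

/-- A tangent vector is determined by its images under the differentials of the height and of the
spherical part. Hence `∂_t` is a coordinate field of every preferred chart. -/
theorem Cylinder.frame_vertical {P q : Cylinder U n}
    (hq : q ∈ (chartAt (ModelProd ℝ (EuclideanSpace ℝ (Fin n))) P).source) :
    frame (𝓘(ℝ, ℝ).prod (𝓡 n)) P q ((1 : ℝ), (0 : EuclideanSpace ℝ (Fin n))) =
      q.verticalField := by
  rw [← sub_eq_zero]
  apply Cylinder.eq_zero
  · rw [map_sub, Cylinder.mvfderiv_height_frame hq, Cylinder.mvfderiv_height_verticalField,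
      sub_self]
  · rw [map_sub, Cylinder.mvfderiv_spherical_frame hq, Cylinder.mvfderiv_spherical_verticalField,
      map_zero, sub_self]

theorem Cylinder.coord_vertical {P q : Cylinder U n}
    (hq : q ∈ (chartAt (ModelProd ℝ (EuclideanSpace ℝ (Fin n))) P).source) :
    coord (𝓘(ℝ, ℝ).prod (𝓡 n)) P q q.verticalField =
      ((1 : ℝ), (0 : EuclideanSpace ℝ (Fin n))) := by
  rw [← Cylinder.frame_vertical hq, coord_frame_of_mem hq]

variable (f : ℝ → ℝ) (hf : ContDiffOn ℝ ∞ f U) (hpos : ∀ t ∈ U, 0 < f t)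

/-- `∂_t` is the gradient of `t`; its tangential part is therefore the gradient of `t` restricted to
the submanifold. -/
theorem inner_verticalField (q : Cylinder U n) (v : TangentSpace (𝓘(ℝ, ℝ).prod (𝓡 n)) q) :
    (warpedMetric (n := n) f hf hpos).inner q q.verticalField v =
      mvfderiv (𝓘(ℝ, ℝ).prod (𝓡 n)) Cylinder.height q v := by
  refine (warpedForm_apply f q _ _).trans ?_
  rw [Cylinder.mvfderiv_height_verticalField, Cylinder.mvfderiv_spherical_verticalField]
  simp

theorem gram_warpedMetric {P q : Cylinder U n}
    (hq : q ∈ (chartAt (ModelProd ℝ (EuclideanSpace ℝ (Fin n))) P).source)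
    (v w : ℝ × EuclideanSpace ℝ (Fin n)) :
    gram (warpedMetric (n := n) f hf hpos) P q v w = v.1 * w.1 + f q.1 ^ 2 *
      inner ℝ (fderiv ℝ (sphereParam P.2) (extChartAt (𝓡 n) P.2 q.2) v.2)
        (fderiv ℝ (sphereParam P.2) (extChartAt (𝓡 n) P.2 q.2) w.2) := by
  have h := warpedForm_apply f q (frame (𝓘(ℝ, ℝ).prod (𝓡 n)) P q v)
    (frame (𝓘(ℝ, ℝ).prod (𝓡 n)) P q w)
  rw [Cylinder.mvfderiv_height_frame hq, Cylinder.mvfderiv_height_frame hq,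
    Cylinder.mvfderiv_spherical_frame hq, Cylinder.mvfderiv_spherical_frame hq] at h
  refine Eq.trans h ?_
  simp [mul_comm]

/-- The coefficient `⟨∂_t, w⟩` is the constant `w.1` on the chart domain. -/
theorem gramDeriv_warpedMetric_vertical (P : Cylinder U n)
    (u w : ℝ × EuclideanSpace ℝ (Fin n)) :
    gramDeriv (warpedMetric (n := n) f hf hpos) P u
      ((1 : ℝ), (0 : EuclideanSpace ℝ (Fin n))) w = 0 := by
  rw [gramDeriv_apply, frame]
  have h : (fun q => gram (warpedMetric (n := n) f hf hpos) P q
      ((1 : ℝ), (0 : EuclideanSpace ℝ (Fin n))) w) =ᶠ[𝓝 P] fun _ => w.1 := by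
    filter_upwards [(chartAt (ModelProd ℝ (EuclideanSpace ℝ (Fin n))) P).open_source.mem_nhds
      (mem_chart_source _ P)] with q hq
    rw [gram_warpedMetric f hf hpos hq]
    simp
  have h2 := congrArg (fun A => A (frame (𝓘(ℝ, ℝ).prod (𝓡 n)) P P u))
    (mvfderiv_const (I := 𝓘(ℝ, ℝ).prod (𝓡 n)) w.1 (x := P))
  exact (congrArg (fun A : ℝ × EuclideanSpace ℝ (Fin n) →L[ℝ] ℝ => A _)
    (h.mfderiv_eq (I := 𝓘(ℝ, ℝ).prod (𝓡 n)) (I' := 𝓘(ℝ, ℝ)))).trans h2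

/-- Only the factor `f²` varies with `t`, and `(f²)' = 2 (f'/f) f²`; the difference on the right is
the spherical part of the metric, factor `f²` included. -/
theorem vertical_gramDeriv_warpedMetric (P : Cylinder U n)
    (v w : ℝ × EuclideanSpace ℝ (Fin n)) :
    gramDeriv (warpedMetric (n := n) f hf hpos) P
      ((1 : ℝ), (0 : EuclideanSpace ℝ (Fin n))) v w = 2 * (deriv f P.1 / f P.1) *
        (gram (warpedMetric (n := n) f hf hpos) P P v w - v.1 * w.1) := by
  have hm := mem_chart_source (ModelProd ℝ (EuclideanSpace ℝ (Fin n))) P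
  have hfP := (hpos P.1 P.1.2).ne'
  have hG : MDifferentiableAt (𝓘(ℝ, ℝ).prod (𝓡 n)) 𝓘(ℝ, ℝ)
      (fun q => gram (warpedMetric (n := n) f hf hpos) P q v w) P :=
    ((mdifferentiableAt_gram _ P).clm_apply mdifferentiableAt_const).clm_apply
      mdifferentiableAt_const
  rw [gramDeriv_apply, mvfderiv_frame hm hG, gram_warpedMetric f hf hpos hm]
  set e := extChartAt (𝓘(ℝ, ℝ).prod (𝓡 n)) P with he
  set K : ℝ := inner ℝ (fderiv ℝ (sphereParam P.2) (extChartAt (𝓡 n) P.2 P.2) v.2)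
        (fderiv ℝ (sphereParam P.2) (extChartAt (𝓡 n) P.2 P.2) w.2) with hK
  -- The derivative along `∂_t` is computed on the coordinate line through `P`, where the spherical
  -- coordinates are frozen and the height is `P.1 + s`.
  have hline := (differentiableAt_comp_extChartAt_symm hG).hasFDerivAt.hasLineDerivAt
    ((1 : ℝ), (0 : EuclideanSpace ℝ (Fin n)))
  rw [HasLineDerivAt] at hline
  have heP : e P = ((P.1 : ℝ), extChartAt (𝓡 n) P.2 P.2) := by
    rw [he, extChartAt_prod]
    rfl
  have hev : (fun s : ℝ => ((fun q => gram (warpedMetric (n := n) f hf hpos) P q v w) ∘ e.symm)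
      (e P + s • ((1 : ℝ), (0 : EuclideanSpace ℝ (Fin n))))) =ᶠ[𝓝 0]
      fun s => v.1 * w.1 + f (P.1 + s) ^ 2 * K := by
    have hc : ContinuousAt (fun s : ℝ => e P + s • ((1 : ℝ), (0 : EuclideanSpace ℝ (Fin n)))) 0 := by
      fun_prop
    have ht : e.target ∈ 𝓝 (e P + (0 : ℝ) • ((1 : ℝ), (0 : EuclideanSpace ℝ (Fin n)))) := by
      rw [zero_smul, add_zero]
      exact extChartAt_target_mem_nhds (I := 𝓘(ℝ, ℝ).prod (𝓡 n)) P
    filter_upwards [hc.preimage_mem_nhds ht] with s hs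
    rw [Set.mem_preimage] at hs
    have hs1 := e.map_target hs
    have hs2 := e.right_inv hs
    rw [he, extChartAt_source, ← he] at hs1
    simp only [Function.comp_apply]
    rw [gram_warpedMetric f hf hpos hs1]
    set q := e.symm (e P + s • ((1 : ℝ), (0 : EuclideanSpace ℝ (Fin n))))
    have hq : e q = ((q.1 : ℝ), extChartAt (𝓡 n) P.2 q.2) := by
      rw [he, extChartAt_prod]
      rfl
    rw [hq, heP] at hs2
    simp only [Prod.smul_mk, Prod.mk_add_mk, Prod.mk.injEq, smul_zero, add_zero, smul_eq_mul,
      mul_one] at hs2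
    rw [hs2.1, hs2.2]
  -- `f` is smooth only on `U`; openness of `U` makes `deriv f` the true derivative there. The `+ 0`
  -- is the parameter `s = 0` on the line.
  have hfd : HasDerivAt f (deriv f P.1) ((P.1 : ℝ) + 0) := by
    rw [add_zero]
    exact ((hf.contDiffAt (U.isOpen.mem_nhds P.1.2)).differentiableAt (by simp)).hasDerivAt
  have h1 := ((((hfd.comp_const_add (P.1 : ℝ) 0).pow 2).mul_const K).const_add (v.1 * w.1))
  have h2 := (hline.congr_of_eventuallyEq hev.symm).unique h1
  refine h2.trans ?_
  simp
  field_simp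

/-- In Koszul's formula two of the three terms differentiate the constant coefficients `⟨∂_t, ·⟩`.
The remaining one is `2 f'/f` times the spherical part of the metric, and the factor `1/2` removes
the `2`. -/
theorem christoffel_vertical (P : Cylinder U n) (u : ℝ × EuclideanSpace ℝ (Fin n)) :
    christoffel (warpedMetric (n := n) f hf hpos) P ((1 : ℝ), (0 : EuclideanSpace ℝ (Fin n))) u =
      (deriv f P.1 / f P.1) • (u - u.1 • ((1 : ℝ), (0 : EuclideanSpace ℝ (Fin n)))) := by
  have hm := mem_chart_source (ModelProd ℝ (EuclideanSpace ℝ (Fin n))) P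
  apply (isInvertible_gram (warpedMetric (n := n) f hf hpos) P).injective
  refine ContinuousLinearMap.ext fun z => ?_
  rw [gram_christoffel, gramDeriv_warpedMetric_vertical, gramDeriv_warpedMetric_vertical,
    vertical_gramDeriv_warpedMetric]
  have h1 : gram (warpedMetric (n := n) f hf hpos) P P
      ((1 : ℝ), (0 : EuclideanSpace ℝ (Fin n))) z = z.1 := by
    rw [gram_warpedMetric f hf hpos hm]
    simp
  simp only [map_smul, map_sub, smul_apply, sub_apply, h1, smul_eq_mul]
  ring

/-! ### The derivative of `∂_t` along a map. -/

section AlongMap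

variable {E : Type*} [NormedAddCommGroup E] [NormedSpace ℝ E]
  {H : Type*} [TopologicalSpace H] {I : ModelWithCorners ℝ E H} [I.Boundaryless]
  {M : Type*} [TopologicalSpace M] [ChartedSpace H M] [IsManifold I ∞ M]
  {x : M → Cylinder U n} {p : M}

theorem coord_verticalField_eventuallyEq (hx : ContinuousAt x p) :
    (fun q => coord (𝓘(ℝ, ℝ).prod (𝓡 n)) (x p) (x q) (x q).verticalField) =ᶠ[𝓝 p]
      fun _ => ((1 : ℝ), (0 : EuclideanSpace ℝ (Fin n))) := by
  filter_upwards [eventually_mem_chart_source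
    (H' := ModelProd ℝ (EuclideanSpace ℝ (Fin n))) hx] with q hq
  exact Cylinder.coord_vertical hq

theorem mdifferentiableAt_coord_verticalField (hx : ContinuousAt x p) :
    MDifferentiableAt I 𝓘(ℝ, ℝ × EuclideanSpace ℝ (Fin n))
      (fun q => coord (𝓘(ℝ, ℝ).prod (𝓡 n)) (x p) (x q) (x q).verticalField) p :=
  mdifferentiableAt_const.congr_of_eventuallyEq (coord_verticalField_eventuallyEq hx)

theorem Cylinder.coord_fst (P : Cylinder U n) (v : TangentSpace (𝓘(ℝ, ℝ).prod (𝓡 n)) P) :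
    (coord (𝓘(ℝ, ℝ).prod (𝓡 n)) P P v).1 =
      mvfderiv (𝓘(ℝ, ℝ).prod (𝓡 n)) Cylinder.height P v := by
  rw [← Cylinder.mvfderiv_height_frame (mem_chart_source _ P), frame_coord]

/-- The vector field `∂_t` of a warped product is conformal and closed. -/
theorem pullbackDerivative_verticalField (hx : ContinuousAt x p) (u : TangentSpace I p) :
    pullbackDerivative (leviCivita (warpedMetric (n := n) f hf hpos)) x
        (fun q => (x q).verticalField) p u =
      (deriv f (x p).height / f (x p).height) •
        (mfderiv I (𝓘(ℝ, ℝ).prod (𝓡 n)) x p u -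
          (warpedMetric (n := n) f hf hpos).inner (x p) (x p).verticalField
            (mfderiv I (𝓘(ℝ, ℝ).prod (𝓡 n)) x p u) • (x p).verticalField) := by
  have hm := mem_chart_source (ModelProd ℝ (EuclideanSpace ℝ (Fin n))) (x p)
  apply IsometricImmersion.injective_coord
  have h0 : mvfderiv I (fun q => coord (𝓘(ℝ, ℝ).prod (𝓡 n)) (x p) (x q) (x q).verticalField) p u
      = 0 := by
    have h1 := congrArg (fun A => A u) (mvfderiv_const (I := I) (x := p)
      ((1 : ℝ), (0 : EuclideanSpace ℝ (Fin n))))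
    exact (congrArg (fun A : E →L[ℝ] ℝ × EuclideanSpace ℝ (Fin n) => A u)
      ((coord_verticalField_eventuallyEq hx).mfderiv_eq (I := I)
        (I' := 𝓘(ℝ, ℝ × EuclideanSpace ℝ (Fin n))))).trans h1
  rw [coord_pullbackDerivative, h0, Cylinder.coord_vertical hm, christoffel_vertical,
    Cylinder.coord_fst, inner_verticalField, map_smul, map_sub, map_smul,
    Cylinder.coord_vertical hm, zero_add]
  rfl

end AlongMap

end Warped
end SubmanifoldGeometry

/-! ### The structure equations for `T` and `ϱ`. -/

theorem proposition3p1 (n k : ℕ)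
    (U : TopologicalSpace.Opens ℝ) (f : ℝ → ℝ)
    (hf : ContDiffOn ℝ ∞ f U) (hpos : ∀ t ∈ U, 0 < f t)
    {M : Type*} [TopologicalSpace M] [ChartedSpace (EuclideanSpace ℝ (Fin k)) M]
    [IsManifold (𝓡 k) ∞ M]
    (g : SubmanifoldGeometry.SmoothMetric (𝓡 k) M)
    (x : SubmanifoldGeometry.IsometricImmersion g
      (SubmanifoldGeometry.warpedMetric (n := n) f hf hpos))
    (T : ∀ p : M, TangentSpace (𝓡 k) p)
    (ϱ : ∀ p : M, TangentSpace (𝓘(ℝ, ℝ).prod (𝓡 n)) (x.toFun p))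
    (hTϱ : ∀ p, (x.toFun p).verticalField = x.differential p (T p) + ϱ p)
    (hϱ : ∀ p (v : TangentSpace (𝓡 k) p),
      (SubmanifoldGeometry.warpedMetric (n := n) f hf hpos).inner (x.toFun p) (ϱ p)
        (x.differential p v) = 0)
    (p : M) (u : TangentSpace (𝓡 k) p) :
    x.secondFundamentalForm p u (T p) + x.normalConnection ϱ p u =
      (-(deriv f (x.toFun p).height / f (x.toFun p).height) * g.inner p u (T p)) • ϱ p ∧
    SubmanifoldGeometry.leviCivita g T p u - x.weingarten p (ϱ p) u =
      (deriv f (x.toFun p).height / f (x.toFun p).height) •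
        (u - g.inner p u (T p) • T p) := by
  have hg : ∀ q (v : TangentSpace (𝓡 k) q), (SubmanifoldGeometry.warpedMetric (n := n) f hf
      hpos).inner (x.toFun q) (x.toFun q).verticalField (x.differential q v) =
      g.inner q (T q) v := by
    intro q v
    rw [hTϱ q, map_add, add_apply, hϱ, add_zero]
    exact x.isometric q (T q) v
  have hc := x.contMDiff_toFun.continuous.continuousAt (x := p)
  -- By `hg`, `T` is the gradient of the height function `t ∘ x`, hence differentiable.
  have hT := SubmanifoldGeometry.mdifferentiableAt_coord_gradient g
    (SubmanifoldGeometry.Cylinder.contMDiff_height.comp x.contMDiff_toFun p) (T := T) (by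
      intro q w
      rw [← hg, SubmanifoldGeometry.inner_verticalField]
      exact (mfderiv_comp_apply (x := q)
        (SubmanifoldGeometry.Cylinder.contMDiff_height.mdifferentiable (by simp) _)
        (x.mdifferentiableAt_toFun q) w).symm)
  have hdT := x.mdifferentiableAt_coord_differential_of_coord hT
  have hdϱ : MDifferentiableAt (𝓡 k) 𝓘(ℝ, ℝ × EuclideanSpace ℝ (Fin n)) (fun q =>
      SubmanifoldGeometry.coord (𝓘(ℝ, ℝ).prod (𝓡 n)) (x.toFun p) (x.toFun q) (ϱ q)) p := by
    -- `ϱ = ∂_t - dx T`, where `∂_t` has locally constant components.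
    have h := (SubmanifoldGeometry.mdifferentiableAt_coord_verticalField (I := 𝓡 k) hc).sub hdT
    refine h.congr_of_eventuallyEq (Filter.Eventually.of_forall fun q => ?_)
    simp [hTϱ q]
  -- Applied with `c = f'/f` and `a = ⟨u, T⟩`; what remains is the closed conformal equation for
  -- `∂_t`, rewritten with `⟨∂_t, dx u⟩ = ⟨T, u⟩`.
  refine x.gauss_weingarten_of_covariantDerivative_eq hT hdϱ hϱ u ?_
  have h1 := SubmanifoldGeometry.pullbackDerivative_verticalField f hf hpos hc u
  have h2 : (fun q => (x.toFun q).verticalField) = fun q => x.differential q (T q) + ϱ q :=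
    funext hTϱ
  have h3 := hg p u
  rw [SubmanifoldGeometry.IsometricImmersion.differential] at h3
  rw [h3, h2, g.symm, hTϱ p] at h1
  exact h1
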